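/- For $q\in\mathbb{C}$ with $|q|<1$ write $(a;q)_n=\prod_{k=0}^{n-1}(1-aq^k)$, $(a;q)_\infty=\prod_{k\ge 0}(1-aq^k)$, and, for integers $0<a<m$, $$J_m=(q^m;q^m)_\infty,\qquad J_{a,m}=(q^a;q^m)_\infty(q^{m-a};q^m)_\infty(q^m;q^m)_\infty .$$ For $u,v,w,t\in\mathbb{C}$ let $$F(u,v,w,t;q^2)=\sum_{i,j,k,l\ge 0}\frac{u^iv^jw^kt^l\,q^{i^2+j^2+k^2+l^2+(i-j-k)l}}{(q^2;q^2)_i(q^2;q^2)_j(q^2;q^2)_k(q^2;q^2)_l}.$$ Then for every $q\in\mathbb{C}$ with $|q|<1$ the series defining $F(u,v,w,t;q^2)$ converges absolutely for all $u,v,w,t\in\mathbb{C}$, and \begin{align*} F(u,v,w,t;q^2)&=F(u,w,v,t;q^2)\qquad\text{for all } u,v,w,t\in\mathbb{C},\\ F(1,1,1,1;q^2)&=\frac{J_2^6J_{14}J_{28}^5}{J_1^3J_4^3J_{2,28}J_{3,28}J_{7,28}J_{8,28}J_{11,28}J_{12,28}}+4q\frac{J_4^3J_{8,28}}{J_2^4},\\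 F(1,1,1,q;q^2)&=\frac{J_2^6J_{14}J_{28}^5}{J_1^3J_4^3J_{4,28}J_{5,28}J_{6,28}J_{7,28}J_{8,28}J_{9,28}}+4q^2\frac{J_4^3J_{4,28}}{J_2^4}, \end{align*} and, if moreover $q\neq 0$, $$F(q^{-1},q,q^{-1},1;q^2)=4\frac{J_4^3J_{12,28}}{J_2^4}+\frac{J_2^6J_{14}J_{28}^5}{J_1^3J_4^3J_{1,28}J_{4,28}J_{7,28}J_{10,28}J_{12,28}J_{13,28}}.$$ -/

import Mathlib

noncomputable section

namespace QSeries

/-- The finite `q`-shifted factorial `(a; q)_n = ∏_{0 ≤ k < n} (1 - a q^k)`. -/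
def qPoch (a q : ℂ) (n : ℕ) : ℂ :=
  ∏ k ∈ Finset.range n, (1 - a * q ^ k)

/-- The infinite `q`-shifted factorial `(a; q)_∞ = ∏_{k ≥ 0} (1 - a q^k)`, for `‖q‖ < 1`. -/
def qPochInf (a q : ℂ) : ℂ :=
  ∏' k : ℕ, (1 - a * q ^ k)

/-- `J_m = (q^m; q^m)_∞`. -/
def J (q : ℂ) (m : ℕ) : ℂ :=
  qPochInf (q ^ m) (q ^ m)

/-- `J_{a,m} = (q^a, q^{m-a}, q^m; q^m)_∞`, for `0 < a < m`. -/
def Jpair (q : ℂ) (a m : ℕ) : ℂ :=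
  qPochInf (q ^ a) (q ^ m) * qPochInf (q ^ (m - a)) (q ^ m) * qPochInf (q ^ m) (q ^ m)

/-- The general term, at `n = (i, j, k, l)`, of the series `F(u, v, w, t; q²)`. The exponent
`i² + j² + k² + l² + (i - j - k) l` of `q` is computed in `ℤ`. -/
def termF (u v w t q : ℂ) (n : ℕ × ℕ × ℕ × ℕ) : ℂ :=
  (u ^ n.1 * v ^ n.2.1 * w ^ n.2.2.1 * t ^ n.2.2.2 *
      q ^ ((n.1 : ℤ) ^ 2 + (n.2.1 : ℤ) ^ 2 + (n.2.2.1 : ℤ) ^ 2 + (n.2.2.2 : ℤ) ^ 2 +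
        ((n.1 : ℤ) - (n.2.1 : ℤ) - (n.2.2.1 : ℤ)) * (n.2.2.2 : ℤ))) /
    (qPoch (q ^ 2) (q ^ 2) n.1 * qPoch (q ^ 2) (q ^ 2) n.2.1 *
      qPoch (q ^ 2) (q ^ 2) n.2.2.1 * qPoch (q ^ 2) (q ^ 2) n.2.2.2)

/-- `F(u, v, w, t; q²)`, the sum over all `i, j, k, l ≥ 0`, as a function of `u, v, w, t`
and `q`. -/
def F (u v w t q : ℂ) : ℂ :=
  ∑' n : ℕ × ℕ × ℕ × ℕ, termF u v w t q n

end QSeries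

end

namespace QSeries

open Filter Topology

/-! ### Infinite products -/

/-! For fixed `l` the exponent has no mixed terms in `i, j, k`, so Euler's expansion turns the sum
over them into three infinite products (`singleTerm`). Splitting `l` by parity turns these into
constant products times finite factors, most of which cancel against `(q²; q²)_l`. One parity leaves
a Rogers–Selberg series with `-q` for `q`, the other a Rogers series modulo 14 in `q²`.

Both families follow from a limiting Bailey lemma, `tsum_altSum`. In `∑ p^{n² + dn} altSum(n, n +
d)`, interchanging sums makes the inner sum a Durfee rectangle sum, equal to `1/(p; p)_∞` whatever
its offset. A theta series with exponent `7r² + ar` remains, a product by Jacobi. The reciprocals of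
the series' denominators are values of `altSum`; their closed forms come from contiguous relations,
in which a sum antisymmetric under reindexing drops out.

What remains is comparing products, with `q = 0` treated separately because the reduction divides by
powers of `q`. -/

lemma summable_norm_geom_mul (a : ℂ) {p : ℂ} (hp : ‖p‖ < 1) :
    Summable fun k : ℕ => ‖-(a * p ^ k)‖ := by
  simp only [norm_neg, norm_mul, norm_pow]
  exact (summable_geometric_of_lt_one (norm_nonneg _) hp).mul_left _

lemma multipliable_qPochInf (a : ℂ) {p : ℂ} (hp : ‖p‖ < 1) :
    Multipliable fun k : ℕ => 1 - a * p ^ k := by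
  simpa [sub_eq_add_neg] using multipliable_one_add_of_summable (summable_norm_geom_mul a hp)

lemma tendsto_qPoch (a : ℂ) {p : ℂ} (hp : ‖p‖ < 1) :
    Tendsto (qPoch a p) atTop (𝓝 (qPochInf a p)) :=
  (multipliable_qPochInf a hp).hasProd.tendsto_prod_nat

lemma qPochInf_ne_zero {a p : ℂ} (hp : ‖p‖ < 1) (h : ∀ k : ℕ, 1 - a * p ^ k ≠ 0) :
    qPochInf a p ≠ 0 := by
  have := tprod_one_add_ne_zero_of_summable (f := fun k : ℕ => -(a * p ^ k))
    (fun k => by simpa [sub_eq_add_neg] using h k) (summable_norm_geom_mul a hp)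
  simpa [qPochInf, sub_eq_add_neg] using this

lemma one_sub_ne_zero_of_norm {a : ℂ} (h : ‖a‖ < 1) : 1 - a ≠ 0 := by
  intro h0
  rw [← sub_eq_zero.1 h0] at h
  simp at h

lemma norm_mul_pow_lt_one {a p : ℂ} (ha : ‖a‖ < 1) (hp : ‖p‖ < 1) (k : ℕ) :
    ‖a * p ^ k‖ < 1 := by
  rw [norm_mul, norm_pow]
  exact (mul_le_of_le_one_right (norm_nonneg _) (pow_le_one₀ (norm_nonneg _) hp.le)).trans_lt ha

lemma qPochInf_ne_zero_of_norm {a p : ℂ} (ha : ‖a‖ < 1) (hp : ‖p‖ < 1) : qPochInf a p ≠ 0 :=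
  qPochInf_ne_zero hp fun k => one_sub_ne_zero_of_norm (norm_mul_pow_lt_one ha hp k)

lemma qPoch_ne_zero_of_norm {a p : ℂ} (ha : ‖a‖ < 1) (hp : ‖p‖ < 1) (n : ℕ) :
    qPoch a p n ≠ 0 :=
  Finset.prod_ne_zero_iff.2 fun k _ => one_sub_ne_zero_of_norm (norm_mul_pow_lt_one ha hp k)

@[simp] lemma qPoch_zero (a p : ℂ) : qPoch a p 0 = 1 := by simp [qPoch]

lemma qPoch_succ (a p : ℂ) (n : ℕ) : qPoch a p (n + 1) = qPoch a p n * (1 - a * p ^ n) :=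
  Finset.prod_range_succ _ _

lemma qPoch_mul_qPochInf (a : ℂ) {p : ℂ} (hp : ‖p‖ < 1) (n : ℕ) :
    qPoch a p n * qPochInf (a * p ^ n) p = qPochInf a p := by
  have h1 : Tendsto (fun m => qPoch a p n * qPoch (a * p ^ n) p m) atTop
      (𝓝 (qPoch a p n * qPochInf (a * p ^ n) p)) := (tendsto_qPoch _ hp).const_mul _
  have h2 : Tendsto (fun m => qPoch a p (m + n)) atTop (𝓝 (qPochInf a p)) :=
    (tendsto_add_atTop_iff_nat n).2 (tendsto_qPoch a hp)
  refine tendsto_nhds_unique h1 (h2.congr fun m => ?_)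
  simp only [qPoch]
  rw [add_comm, Finset.prod_range_add]
  congr 1
  refine Finset.prod_congr rfl fun k _ => ?_
  rw [pow_add]; ring

lemma qPochInf_eq_one_sub_mul (a : ℂ) {p : ℂ} (hp : ‖p‖ < 1) :
    qPochInf a p = (1 - a) * qPochInf (a * p) p := by
  have := qPoch_mul_qPochInf a hp 1
  simpa [qPoch] using this.symm

/-- Splitting the factors of `(a; p)_∞` by the residue of their index modulo `d`. -/
lemma qPochInf_dissect (a : ℂ) {p : ℂ} (hp : ‖p‖ < 1) {d : ℕ} (hd : d ≠ 0) :
    qPochInf a p = ∏ i ∈ Finset.range d, qPochInf (a * p ^ i) (p ^ d) := by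
  have hpd : ‖p ^ d‖ < 1 := by
    rw [norm_pow]; exact pow_lt_one₀ (norm_nonneg _) hp hd
  have h1 : Tendsto (fun m => ∏ i ∈ Finset.range d, qPoch (a * p ^ i) (p ^ d) m) atTop
      (𝓝 (∏ i ∈ Finset.range d, qPochInf (a * p ^ i) (p ^ d))) :=
    tendsto_finsetProd _ fun i _ => tendsto_qPoch _ hpd
  have h2 : Tendsto (fun m : ℕ => qPoch a p (m * d)) atTop (𝓝 (qPochInf a p)) :=
    (tendsto_qPoch a hp).comp (tendsto_id.atTop_mul_const' (Nat.pos_of_ne_zero hd))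
  refine tendsto_nhds_unique h2 (h1.congr fun m => ?_)
  induction m with
  | zero => simp
  | succ m ih =>
    simp only [qPoch_succ, Finset.prod_mul_distrib]
    rw [ih, add_mul, one_mul]
    simp only [qPoch]
    rw [Finset.prod_range_add]
    congr 1
    refine Finset.prod_congr rfl fun k _ => ?_
    rw [← pow_mul, pow_add, mul_comm d m]; ring

/-- `(a; p)_∞ (-a; p)_∞ = (a²; p²)_∞`. -/
lemma qPochInf_mul_neg (a : ℂ) {p : ℂ} (hp : ‖p‖ < 1) :
    qPochInf a p * qPochInf (-a) p = qPochInf (a ^ 2) (p ^ 2) := by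
  rw [qPochInf, qPochInf, qPochInf,
    ← (multipliable_qPochInf a hp).tprod_mul (multipliable_qPochInf (-a) hp)]
  refine tprod_congr fun k => ?_
  rw [← pow_mul, mul_comm 2 k, pow_mul]; ring

/-! ### Reciprocals of `(p; p)_a` for integral `a` -/

/-- `1 / (p; p)_a`, which is zero for negative `a`. -/
noncomputable def rq (p : ℂ) (a : ℤ) : ℂ := if a < 0 then 0 else (qPoch p p a.toNat)⁻¹

lemma rq_of_neg (p : ℂ) {a : ℤ} (h : a < 0) : rq p a = 0 := by simp [rq, h]

@[simp] lemma rq_natCast (p : ℂ) (n : ℕ) : rq p n = (qPoch p p n)⁻¹ := by simp [rq]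

@[simp] lemma rq_zero (p : ℂ) : rq p 0 = 1 := by simp [rq]

/-- At `a = 0` both sides vanish, so the recurrence holds for every integer and sums over `ℤ` can be
shifted without boundary terms. -/
lemma rq_sub_one {p : ℂ} (hp : ‖p‖ < 1) (a : ℤ) : rq p (a - 1) = (1 - p ^ a) * rq p a := by
  rcases lt_trichotomy a 0 with h | rfl | h
  · rw [rq_of_neg p h, rq_of_neg p (by omega), mul_zero]
  · simp [rq]
  · obtain ⟨n, rfl⟩ : ∃ n : ℕ, a = (n + 1 : ℕ) := ⟨(a - 1).toNat, by omega⟩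
    have h1 : ((n + 1 : ℕ) : ℤ) - 1 = n := by push_cast; ring
    rw [h1, rq_natCast, rq_natCast, qPoch_succ, zpow_natCast, ← pow_succ', mul_inv]
    have : 1 - p ^ (n + 1) ≠ 0 := by
      have := one_sub_ne_zero_of_norm (norm_mul_pow_lt_one hp hp n)
      rwa [← pow_succ'] at this
    field_simp

lemma tendsto_rq {p : ℂ} (hp : ‖p‖ < 1) :
    Tendsto (fun n : ℕ => rq p n) atTop (𝓝 (qPochInf p p)⁻¹) := by
  simp only [rq_natCast]
  exact (tendsto_qPoch p hp).inv₀ (qPochInf_ne_zero_of_norm hp hp)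

lemma exists_norm_rq_le {p : ℂ} (hp : ‖p‖ < 1) : ∃ C : ℝ, 0 < C ∧ ∀ a, ‖rq p a‖ ≤ C := by
  obtain ⟨C, hC⟩ := (tendsto_rq hp).norm.bddAbove_range
  refine ⟨max C 1, by positivity, fun a => ?_⟩
  rcases lt_or_ge a 0 with h | h
  · rw [rq_of_neg p h, norm_zero]; positivity
  · lift a to ℕ using h
    exact (hC ⟨a, rfl⟩).trans (le_max_left _ _)

lemma support_rq_mul_subset (p : ℂ) (f : ℤ → ℂ) :
    Function.support (fun a : ℤ => rq p a * f a) ⊆ Set.range ((↑) : ℕ → ℤ) := by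
  intro a ha
  rcases lt_or_ge a 0 with h | h
  · simp [rq_of_neg p h] at ha
  · exact ⟨a.toNat, by omega⟩

lemma tsum_rq_mul (p : ℂ) (f : ℤ → ℂ) :
    ∑' a : ℤ, rq p a * f a = ∑' n : ℕ, rq p n * f n :=
  (Nat.cast_injective.tsum_eq (support_rq_mul_subset p f)).symm

lemma summable_rq_mul (p : ℂ) (f : ℤ → ℂ) :
    Summable (fun a : ℤ => ‖rq p a * f a‖) ↔ Summable fun n : ℕ => ‖rq p n * f n‖ := by
  refine (Nat.cast_injective.summable_iff fun a ha => ?_).symm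
  by_contra h
  exact ha (support_rq_mul_subset p f (by simpa using h))

/-! ### Summability of Gaussian-type series -/

lemma summable_int_pow_natAbs {x : ℝ} (h0 : 0 ≤ x) (h1 : x < 1) :
    Summable fun n : ℤ => x ^ n.natAbs := by
  apply Summable.of_nat_of_neg <;> simpa using summable_geometric_of_lt_one h0 h1

lemma summable_norm_zpow {y : ℂ} (hy0 : y ≠ 0) (hy : ‖y‖ < 1) {e : ℤ → ℤ} (K : ℤ)
    (h : ∀ n, |n| ≤ e n + K) : Summable fun n : ℤ => ‖y ^ e n‖ := by
  have hpos : 0 < ‖y‖ := norm_pos_iff.2 hy0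
  refine Summable.of_nonneg_of_le (fun _ => norm_nonneg _) (fun n => ?_)
    ((summable_int_pow_natAbs hpos.le hy).mul_left (‖y‖ ^ (-K)))
  rw [norm_zpow, ← zpow_natCast, ← zpow_add₀ hpos.ne']
  refine zpow_le_zpow_right_of_le_one₀ hpos hy.le ?_
  have := h n
  rw [Int.natCast_natAbs]; omega

/-- The term is `(|u| s^i)^i`, whose base tends to zero and is eventually below `1/2`. -/
lemma summable_pow_mul_pow_sq (u : ℝ) {s : ℝ} (hs0 : 0 ≤ s) (hs : s < 1) :
    Summable fun i : ℕ => |u| ^ i * s ^ (i ^ 2) := by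
  have ht : Tendsto (fun i : ℕ => |u| * s ^ i) atTop (𝓝 0) := by
    simpa using (tendsto_pow_atTop_nhds_zero_of_lt_one hs0 hs).const_mul |u|
  refine summable_of_isBigO_nat (summable_geometric_of_lt_one (r := 1 / 2) (by norm_num)
    (by norm_num)) (Asymptotics.IsBigO.of_bound 1 ?_)
  filter_upwards [ht.eventually (gt_mem_nhds (show (0 : ℝ) < 1 / 2 by norm_num))] with i hi
  have h0 : 0 ≤ |u| * s ^ i := by positivity
  rw [sq, pow_mul, ← mul_pow, one_mul, norm_pow, norm_pow, Real.norm_of_nonneg h0,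
    Real.norm_of_nonneg (by norm_num)]
  exact pow_le_pow_left₀ h0 hi.le i

lemma summable_norm_euler (z : ℂ) {y : ℂ} (hy : ‖y‖ < 1) {p : ℂ} (hp : ‖p‖ < 1) :
    Summable fun n : ℕ => ‖rq p n * (z ^ n * y ^ (n ^ 2))‖ := by
  obtain ⟨C, hC, hb⟩ := exists_norm_rq_le hp
  refine Summable.of_nonneg_of_le (fun _ => norm_nonneg _) (fun n => ?_)
    ((summable_pow_mul_pow_sq ‖z‖ (norm_nonneg y) hy).mul_left C)
  rw [norm_mul, norm_mul, norm_pow, norm_pow, abs_norm]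
  exact mul_le_mul_of_nonneg_right (hb _) (by positivity)

/-! ### Euler's expansion -/

lemma norm_sq_lt_one {y : ℂ} (hy : ‖y‖ < 1) : ‖y ^ 2‖ < 1 := by
  rw [norm_pow]; exact pow_lt_one₀ (norm_nonneg _) hy two_ne_zero

/-- Subtracting the two series puts a factor `1 - y^{2n}` in the `n`-th term; it lowers the index of
`rq` by one, and `n ↦ n + 1` recovers the second series. -/
lemma euler_functional (z : ℂ) {y : ℂ} (hy : ‖y‖ < 1) :
    ∑' n : ℕ, rq (y ^ 2) n * (z ^ n * y ^ (n ^ 2)) =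
      (1 + z * y) * ∑' n : ℕ, rq (y ^ 2) n * ((z * y ^ 2) ^ n * y ^ (n ^ 2)) := by
  have hp := norm_sq_lt_one hy
  have h1 := (summable_norm_euler z hy hp).of_norm
  have h2 := (summable_norm_euler (z * y ^ 2) hy hp).of_norm
  have h3 : ∑' n : ℕ, rq (y ^ 2) n * (z ^ n * y ^ (n ^ 2)) -
      ∑' n : ℕ, rq (y ^ 2) n * ((z * y ^ 2) ^ n * y ^ (n ^ 2)) =
      z * y * ∑' n : ℕ, rq (y ^ 2) n * ((z * y ^ 2) ^ n * y ^ (n ^ 2)) := by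
    rw [← h1.tsum_sub h2, (h1.sub h2).tsum_eq_zero_add, ← tsum_mul_left]
    simp only [Nat.cast_zero, rq_zero, pow_zero, ne_eq, OfNat.ofNat_ne_zero, not_false_eq_true,
      zero_pow, mul_one, sub_self, zero_add]
    refine tsum_congr fun n => ?_
    have := rq_sub_one hp (n + 1 : ℕ)
    rw [show ((n + 1 : ℕ) : ℤ) - 1 = n by push_cast; ring, zpow_natCast] at this
    rw [this]
    ring
  linear_combination h3

theorem tsum_euler (z : ℂ) {y : ℂ} (hy : ‖y‖ < 1) :
    ∑' n : ℕ, rq (y ^ 2) n * (z ^ n * y ^ (n ^ 2)) = qPochInf (-(z * y)) (y ^ 2) := by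
  have hp := norm_sq_lt_one hy
  have hit : ∀ m : ℕ, ∑' n : ℕ, rq (y ^ 2) n * (z ^ n * y ^ (n ^ 2)) =
      qPoch (-(z * y)) (y ^ 2) m *
        ∑' n : ℕ, rq (y ^ 2) n * ((z * (y ^ 2) ^ m) ^ n * y ^ (n ^ 2)) := by
    intro m
    induction m with
    | zero => simp
    | succ m ih =>
      rw [ih, euler_functional _ hy, qPoch_succ, pow_succ (y ^ 2) m, ← mul_assoc z]
      ring
  -- After `m` uses of the functional equation the argument is `z y^{2m} → 0`, so only the `n = 0`
  -- term survives.
  have h1 : Tendsto (fun m : ℕ => ∑' n : ℕ, rq (y ^ 2) n * ((z * (y ^ 2) ^ m) ^ n * y ^ (n ^ 2)))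
      atTop (𝓝 (∑' n : ℕ, rq (y ^ 2) n * ((z * 0) ^ n * y ^ (n ^ 2)))) := by
    refine tendsto_tsum_of_dominated_convergence (summable_norm_euler z hy hp) (fun n => ?_)
      (Eventually.of_forall fun m n => ?_)
    · exact ((((tendsto_pow_atTop_nhds_zero_of_norm_lt_one hp).const_mul z).pow n).mul_const
        _).const_mul _
    · simp only [norm_mul, norm_pow]
      gcongr
      exact mul_le_of_le_one_right (norm_nonneg _)
        (pow_le_one₀ (by positivity) (pow_le_one₀ (norm_nonneg _) hy.le))
  have h2 : ∑' n : ℕ, rq (y ^ 2) n * ((z * 0) ^ n * y ^ (n ^ 2)) = 1 := by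
    rw [tsum_eq_single 0 fun n hn => by simp [hn]]
    simp
  rw [h2] at h1
  have h3 := (tendsto_qPoch (-(z * y)) hp).mul h1
  rw [mul_one] at h3
  exact tendsto_nhds_unique (tendsto_const_nhds.congr hit) h3

/-! ### The Durfee rectangle identity -/

/-- `∑ p^{m² + cm} / ((p; p)_m (p; p)_{m+c})`. -/
noncomputable def durfee (p : ℂ) (c : ℤ) : ℂ :=
  ∑' m : ℤ, p ^ (m ^ 2 + c * m) * (rq p m * rq p (m + c))

lemma durfee_neg (p : ℂ) (c : ℤ) : durfee p (-c) = durfee p c := by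
  rw [durfee, ← (Equiv.addRight c).tsum_eq, durfee]
  refine tsum_congr fun m => ?_
  simp only [Equiv.coe_addRight]
  rw [show (m + c) ^ 2 + -c * (m + c) = m ^ 2 + c * m by ring, add_neg_cancel_right]
  ring

lemma summable_norm_sq_add_mul {p : ℂ} (hp0 : p ≠ 0) (hp : ‖p‖ < 1) (c : ℤ) :
    Summable fun m : ℤ => ‖p ^ (m ^ 2 + c * m)‖ := by
  refine summable_norm_zpow hp0 hp ((|c| + 1) ^ 2) fun m => ?_
  have h1 : -(|c| * |m|) ≤ c * m := by rw [← abs_mul]; exact neg_abs_le _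
  have h2 := sq_abs m
  nlinarith [abs_nonneg c, abs_nonneg m, sq_nonneg (|m| - (|c| + 1))]

lemma summable_norm_durfee_aux {p : ℂ} (hp0 : p ≠ 0) (hp : ‖p‖ < 1) (c : ℤ) (f g : ℤ → ℤ) :
    Summable fun m : ℤ => ‖p ^ (m ^ 2 + c * m) * (rq p (f m) * rq p (g m))‖ := by
  obtain ⟨C, hC, hb⟩ := exists_norm_rq_le hp
  refine Summable.of_nonneg_of_le (fun _ => norm_nonneg _) (fun m => ?_)
    ((summable_norm_sq_add_mul hp0 hp c).mul_right (C * C))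
  rw [norm_mul, norm_mul]
  gcongr <;> exact hb _

/-- With `1/(p; p)_{m+c+1}` factored out, the difference of terms carries `(1 - p^m) - p^{m+c+1}`.
The first part lowers the index `m`, giving the sum at `c + 2` after a shift; the second gives the
sum at `c + 1`. -/
lemma durfee_recurrence {p : ℂ} (hp0 : p ≠ 0) (hp : ‖p‖ < 1) (c : ℤ) :
    durfee p c - durfee p (c + 1) = -p ^ (c + 1) * (durfee p (c + 1) - durfee p (c + 2)) := by
  have hA := (summable_norm_durfee_aux hp0 hp c (fun m => m) (· + c)).of_norm
  have hB := (summable_norm_durfee_aux hp0 hp (c + 1) (fun m => m) (· + (c + 1))).of_norm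
  have hS : p ^ (c + 1) * durfee p (c + 2) =
      ∑' m : ℤ, p ^ (m ^ 2 + c * m) * (rq p (m - 1) * rq p (m + (c + 1))) := by
    rw [durfee, ← tsum_mul_left, ← (Equiv.subRight (1 : ℤ)).tsum_eq]
    refine tsum_congr fun m => ?_
    simp only [Equiv.subRight_apply]
    rw [← mul_assoc, ← zpow_add₀ hp0]
    congr 2
    · ring
    · congr 1; ring_nf
  have hC := (summable_norm_durfee_aux hp0 hp c (· - 1) (· + (c + 1))).of_norm
  have key : durfee p c - durfee p (c + 1) =
      p ^ (c + 1) * durfee p (c + 2) - p ^ (c + 1) * durfee p (c + 1) := by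
    rw [hS, durfee, durfee, ← tsum_mul_left, ← hA.tsum_sub hB, ← hC.tsum_sub (hB.mul_left _)]
    refine tsum_congr fun m => ?_
    have h1 := rq_sub_one hp m
    have h2 := rq_sub_one hp (m + (c + 1))
    rw [show m + (c + 1) - 1 = m + c by ring] at h2
    rw [h1, h2, show m ^ 2 + (c + 1) * m = (m ^ 2 + c * m) + m by ring,
      zpow_add₀ hp0 (m ^ 2 + c * m) m, zpow_add₀ hp0 m (c + 1)]
    ring
  rw [key]; ring

lemma exists_norm_durfee_le {p : ℂ} (hp0 : p ≠ 0) (hp : ‖p‖ < 1) :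
    ∃ B : ℝ, ∀ c : ℕ, ‖durfee p c‖ ≤ B := by
  obtain ⟨C, hC, hb⟩ := exists_norm_rq_le hp
  have hs := summable_norm_sq_add_mul hp0 hp 0
  refine ⟨∑' m : ℤ, ‖p ^ (m ^ 2 + 0 * m)‖ * (C * C), fun c => ?_⟩
  refine tsum_of_norm_bounded (hs.mul_right _).hasSum fun m => ?_
  rcases lt_or_ge m 0 with h | h
  · rw [rq_of_neg p h]; simp; positivity
  · rw [norm_mul, norm_mul]
    gcongr ?_ * (?_ * ?_)
    · rw [norm_zpow, norm_zpow]
      refine zpow_le_zpow_right_of_le_one₀ (norm_pos_iff.2 hp0) hp.le ?_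
      have : 0 ≤ (c : ℤ) * m := by positivity
      linarith
    · exact hb _
    · exact hb _

/-- By the recurrence each consecutive difference is at most `‖p‖` times the next one; the
differences are bounded, so they are all zero. -/
lemma durfee_succ {p : ℂ} (hp0 : p ≠ 0) (hp : ‖p‖ < 1) (c : ℕ) :
    durfee p c = durfee p (c + 1 : ℕ) := by
  obtain ⟨B, hB⟩ := exists_norm_durfee_le hp0 hp
  have hstep : ∀ c : ℕ, ‖durfee p c - durfee p (c + 1 : ℕ)‖ ≤
      ‖p‖ * ‖durfee p (c + 1 : ℕ) - durfee p (c + 1 + 1 : ℕ)‖ := by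
    intro c
    have := durfee_recurrence hp0 hp c
    push_cast
    rw [this, norm_mul, norm_neg, add_assoc, one_add_one_eq_two]
    gcongr
    rw [show (c : ℤ) + 1 = (c + 1 : ℕ) by push_cast; rfl, zpow_natCast, norm_pow]
    exact pow_le_of_le_one (norm_nonneg _) hp.le (by omega)
  have hit : ∀ n c : ℕ, ‖durfee p c - durfee p (c + 1 : ℕ)‖ ≤ ‖p‖ ^ n * (B + B) := by
    intro n
    induction n with
    | zero =>
      intro c
      rw [pow_zero, one_mul]
      exact (norm_sub_le _ _).trans (add_le_add (hB _) (hB _))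
    | succ n ih =>
      intro c
      refine (hstep c).trans ?_
      rw [pow_succ', mul_assoc]
      exact mul_le_mul_of_nonneg_left (ih _) (norm_nonneg _)
  have hlim : Tendsto (fun n : ℕ => ‖p‖ ^ n * (B + B)) atTop (𝓝 0) := by
    simpa using (tendsto_pow_atTop_nhds_zero_of_lt_one (norm_nonneg _) hp).mul_const (B + B)
  have h0 := ge_of_tendsto' hlim fun n => hit n c
  exact sub_eq_zero.1 (norm_le_zero_iff.1 h0)

/-- As `c → ∞` the factor `p^{cm}` kills every `m > 0`, and negative `m` never contribute; the `m =
0` term tends to the limit. -/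
lemma tendsto_durfee {p : ℂ} (hp0 : p ≠ 0) (hp : ‖p‖ < 1) :
    Tendsto (fun c : ℕ => durfee p c) atTop (𝓝 (qPochInf p p)⁻¹) := by
  obtain ⟨C, hC, hb⟩ := exists_norm_rq_le hp
  have h1 : (qPochInf p p)⁻¹ = ∑' m : ℤ, if m = 0 then (qPochInf p p)⁻¹ else 0 := by simp
  rw [h1]
  refine tendsto_tsum_of_dominated_convergence
    ((summable_norm_sq_add_mul hp0 hp 0).mul_right (C * C)) (fun m => ?_)
    (Eventually.of_forall fun c m => ?_)
  · rcases lt_trichotomy m 0 with h | rfl | h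
    · simp [rq_of_neg p h, h.ne]
    · simpa using tendsto_rq hp
    · rw [if_neg h.ne']
      lift m to ℕ using h.le
      have hm : m ≠ 0 := by rintro rfl; simp at h
      have hl : Tendsto (fun c : ℕ => ‖p‖ ^ c * (C * C)) atTop (𝓝 0) := by
        simpa using (tendsto_pow_atTop_nhds_zero_of_lt_one (norm_nonneg _) hp).mul_const (C * C)
      refine squeeze_zero_norm (fun c => ?_) hl
      rw [norm_mul, norm_mul]
      gcongr ?_ * (?_ * ?_)
      · rw [show (m : ℤ) ^ 2 + c * m = (m ^ 2 + c * m : ℕ) by push_cast; rfl, zpow_natCast,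
          norm_pow]
        refine pow_le_pow_of_le_one (norm_nonneg _) hp.le ?_
        have : c * 1 ≤ c * m := Nat.mul_le_mul_left _ (Nat.one_le_iff_ne_zero.2 hm)
        have : 0 ≤ m ^ 2 := by positivity
        omega
      · exact hb _
      · exact hb _
  · rcases lt_or_ge m 0 with h | h
    · rw [rq_of_neg p h]; simp; positivity
    · rw [norm_mul, norm_mul]
      gcongr ?_ * (?_ * ?_)
      · rw [norm_zpow, norm_zpow]
        refine zpow_le_zpow_right_of_le_one₀ (norm_pos_iff.2 hp0) hp.le ?_
        have : 0 ≤ (c : ℤ) * m := by positivity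
        linarith
      · exact hb _
      · exact hb _

theorem durfee_eq {p : ℂ} (hp0 : p ≠ 0) (hp : ‖p‖ < 1) (c : ℤ) :
    durfee p c = (qPochInf p p)⁻¹ := by
  have hn : ∀ c : ℕ, durfee p c = (qPochInf p p)⁻¹ := by
    have h0 : ∀ c : ℕ, durfee p c = durfee p (0 : ℕ) := by
      intro c
      induction c with
      | zero => rfl
      | succ c ih => rw [← durfee_succ hp0 hp, ih]
    intro c
    rw [h0]
    exact tendsto_nhds_unique (tendsto_const_nhds.congr fun c => (h0 c).symm)
      (tendsto_durfee hp0 hp)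
  rcases le_total 0 c with h | h
  · lift c to ℕ using h
    exact hn c
  · obtain ⟨d, rfl⟩ : ∃ d : ℕ, c = -d := ⟨(-c).toNat, by omega⟩
    rw [durfee_neg, hn]

/-! ### Jacobi's triple product -/

lemma tsum_euler_int (z : ℂ) {y : ℂ} (hy : ‖y‖ < 1) :
    ∑' n : ℤ, rq (y ^ 2) n * (z ^ n * y ^ (n ^ 2)) = qPochInf (-(z * y)) (y ^ 2) := by
  rw [tsum_rq_mul, ← tsum_euler z hy]
  refine tsum_congr fun n => ?_
  norm_cast

lemma summable_norm_euler_int (z : ℂ) {y : ℂ} (hy : ‖y‖ < 1) {p : ℂ} (hp : ‖p‖ < 1) :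
    Summable fun n : ℤ => ‖rq p n * (z ^ n * y ^ (n ^ 2))‖ := by
  rw [summable_rq_mul]
  refine (summable_norm_euler z hy hp).congr fun n => ?_
  norm_cast

theorem jacobi_triple_product {z y : ℂ} (hz : z ≠ 0) (hy0 : y ≠ 0) (hy : ‖y‖ < 1) :
    ∑' r : ℤ, z ^ r * y ^ (r ^ 2) = qPochInf (-(z * y)) (y ^ 2) *
      qPochInf (-(z⁻¹ * y)) (y ^ 2) * qPochInf (y ^ 2) (y ^ 2) := by
  have hp := norm_sq_lt_one hy
  have hp0 : y ^ 2 ≠ 0 := pow_ne_zero _ hy0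
  have h1 := summable_norm_euler_int z hy hp
  have h2 := summable_norm_euler_int z⁻¹ hy hp
  -- Terms of the product of two Euler series are grouped by the net power `r` of `z`; for each `r`
  -- the remaining sum is `durfee (y ^ 2) r`.
  let e : ℤ × ℤ ≃ ℤ × ℤ :=
    { toFun := fun x => (x.2 + x.1, x.2)
      invFun := fun x => (x.1 - x.2, x.2)
      left_inv := fun x => by simp
      right_inv := fun x => by simp }
  have hs := summable_mul_of_summable_norm h1 h2
  have h3 : qPochInf (-(z * y)) (y ^ 2) * qPochInf (-(z⁻¹ * y)) (y ^ 2) =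
      ∑' r : ℤ, (z ^ r * y ^ (r ^ 2)) * (qPochInf (y ^ 2) (y ^ 2))⁻¹ := by
    rw [← tsum_euler_int z hy, ← tsum_euler_int z⁻¹ hy, tsum_mul_tsum_of_summable_norm h1 h2,
      ← e.tsum_eq]
    refine (((e.summable_iff).2 hs).tsum_prod).trans (tsum_congr fun r => ?_)
    rw [← durfee_eq hp0 hp r, durfee, ← tsum_mul_left]
    refine tsum_congr fun m => ?_
    simp only [e, Equiv.coe_fn_mk, Function.comp_apply]
    have hyy : ∀ a : ℤ, (y ^ 2) ^ a = y ^ (2 * a) := fun a => by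
      rw [zpow_mul]; norm_cast
    rw [hyy, inv_zpow, zpow_add₀ hz, show 2 * (m ^ 2 + r * m) = (m + r) ^ 2 + m ^ 2 - r ^ 2 by ring,
      zpow_sub₀ hy0, zpow_add₀ hy0]
    have := zpow_ne_zero m hz
    have := zpow_ne_zero (r ^ 2) hy0
    field_simp
  rw [h3, tsum_mul_right, mul_assoc, inv_mul_cancel₀ (qPochInf_ne_zero_of_norm hp hp), mul_one]

/-- `∑ (-1)^r y^{7r² + ar}`. -/
noncomputable def theta (y : ℂ) (a : ℤ) : ℂ := ∑' r : ℤ, (-1) ^ r * y ^ (7 * r ^ 2 + a * r)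

theorem theta_eq_Jpair {y : ℂ} (hy0 : y ≠ 0) (hy : ‖y‖ < 1) {a : ℕ} (ha : a ≤ 7) :
    theta y a = Jpair y (7 - a) 14 := by
  have h7 : ‖y ^ 7‖ < 1 := by
    rw [norm_pow]; exact pow_lt_one₀ (norm_nonneg _) hy (by norm_num)
  have h := jacobi_triple_product (z := -y ^ a) (neg_ne_zero.2 (pow_ne_zero a hy0))
    (pow_ne_zero 7 hy0) h7
  rw [theta, Jpair, mul_comm (qPochInf (y ^ (7 - a)) _)]
  rw [show -(-y ^ a * y ^ 7) = y ^ (14 - (7 - a)) by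
      rw [show 14 - (7 - a) = a + 7 by omega, pow_add]; ring,
    show -((-y ^ a)⁻¹ * y ^ 7) = y ^ (7 - a) by
      rw [pow_sub₀ _ hy0 ha, inv_neg]; ring, ← pow_mul] at h
  rw [← h]
  refine tsum_congr fun r => ?_
  rw [neg_eq_neg_one_mul (y ^ a), mul_zpow, ← zpow_natCast, ← zpow_natCast, ← zpow_mul,
    ← zpow_mul, mul_assoc, ← zpow_add₀ hy0]
  push_cast
  ring_nf

/-! ### Finite alternating theta sums -/

/-- `∑ (-1)^r y^{3r² + er} / ((p; p)_{M - fr} (p; p)_{N + fr})`. -/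
noncomputable def altSum (p y : ℂ) (f e M N : ℤ) : ℂ :=
  ∑' r : ℤ, (-1) ^ r * y ^ (3 * r ^ 2 + e * r) * (rq p (M - f * r) * rq p (N + f * r))

section altSum

variable {p y : ℂ} {f g : ℤ}

lemma summable_norm_cubic_weight (hy0 : y ≠ 0) (hy : ‖y‖ < 1) (e : ℤ) :
    Summable fun r : ℤ => ‖(-1) ^ r * y ^ (3 * r ^ 2 + e * r)‖ := by
  simp only [norm_mul, norm_zpow, norm_neg, norm_one, one_zpow, one_mul]
  simp only [← norm_zpow]
  refine summable_norm_zpow hy0 hy ((|e| + 1) ^ 2) fun m => ?_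
  have h1 : -(|e| * |m|) ≤ e * m := by rw [← abs_mul]; exact neg_abs_le _
  have h2 := sq_abs m
  nlinarith [abs_nonneg e, abs_nonneg m, sq_nonneg (|m| - (|e| + 1)), sq_nonneg m]

lemma summable_altSum (hp : ‖p‖ < 1) (hy0 : y ≠ 0) (hy : ‖y‖ < 1) (e : ℤ) (a b : ℤ → ℤ) :
    Summable fun r : ℤ => (-1) ^ r * y ^ (3 * r ^ 2 + e * r) * (rq p (a r) * rq p (b r)) := by
  obtain ⟨C, hC, hb⟩ := exists_norm_rq_le hp
  refine Summable.of_norm_bounded ((summable_norm_cubic_weight hy0 hy e).mul_right (C * C))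
    fun r => ?_
  rw [norm_mul, norm_mul (rq p (a r))]
  gcongr <;> exact hb _

lemma altSum_neg (e M N : ℤ) : altSum p y f (-e) M N = altSum p y f e N M := by
  rw [altSum, ← (Equiv.neg ℤ).tsum_eq, altSum]
  refine tsum_congr fun r => ?_
  simp only [Equiv.neg_apply]
  rw [show (-1 : ℂ) ^ (-r) = (-1) ^ r by rw [zpow_neg, ← inv_zpow, inv_neg, inv_one]]
  rw [show 3 * (-r) ^ 2 + -e * -r = 3 * r ^ 2 + e * r by ring, mul_neg, sub_neg_eq_add,
    ← sub_eq_add_neg]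
  ring

/-- Reindexing by `r ↦ r - 1`. Combined with `altSum_neg` it maps `e = 3` with `N - M = f` to its
own negative, so those sums vanish. -/
lemma altSum_shift (hy0 : y ≠ 0) (e M N : ℤ) :
    altSum p y f e M N = -y ^ (3 - e) * altSum p y f (e - 6) (M + f) (N - f) := by
  rw [altSum, ← (Equiv.subRight (1 : ℤ)).tsum_eq, altSum, ← tsum_mul_left]
  refine tsum_congr fun r => ?_
  simp only [Equiv.subRight_apply]
  rw [show 3 * (r - 1) ^ 2 + e * (r - 1) = (3 - e) + (3 * r ^ 2 + (e - 6) * r) by ring,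
    zpow_add₀ hy0, show M - f * (r - 1) = M + f - f * r by ring,
    show N + f * (r - 1) = N - f + f * r by ring, zpow_sub_one₀ (by norm_num : (-1 : ℂ) ≠ 0)]
  norm_num
  ring

/-- Lowering the index costs a factor `1 - p^{M - fr}`; since `p^f = y^g`, its second part only
shifts the linear exponent `e` by `g`. -/
lemma altSum_sub_left (hp0 : p ≠ 0) (hp : ‖p‖ < 1) (hy0 : y ≠ 0) (hy : ‖y‖ < 1)
    (hpy : p ^ f = y ^ g) (e M N : ℤ) :
    altSum p y f e (M - 1) N = altSum p y f e M N - p ^ M * altSum p y f (e - g) M N := by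
  rw [altSum, altSum, altSum, ← tsum_mul_left, ← (summable_altSum hp hy0 hy _ _ _).tsum_sub
    ((summable_altSum hp hy0 hy _ _ _).mul_left _)]
  refine tsum_congr fun r => ?_
  rw [show M - 1 - f * r = M - f * r - 1 by ring, rq_sub_one hp, zpow_sub₀ hp0 M,
    zpow_mul p f, hpy, ← zpow_mul, show 3 * r ^ 2 + (e - g) * r = 3 * r ^ 2 + e * r - g * r by ring,
    zpow_sub₀ hy0 (3 * r ^ 2 + e * r)]
  ring

lemma altSum_sub_right (hp0 : p ≠ 0) (hp : ‖p‖ < 1) (hy0 : y ≠ 0) (hy : ‖y‖ < 1)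
    (hpy : p ^ f = y ^ g) (e M N : ℤ) :
    altSum p y f e M (N - 1) = altSum p y f e M N - p ^ N * altSum p y f (e + g) M N := by
  rw [← altSum_neg e, altSum_sub_left hp0 hp hy0 hy hpy, altSum_neg,
    show -e - g = -(e + g) by ring, altSum_neg]

lemma altSum_zero_zero (p y : ℂ) {f : ℤ} (hf : 0 < f) (e : ℤ) : altSum p y f e 0 0 = 1 := by
  rw [altSum, tsum_eq_single 0 fun r hr => ?_]
  · simp
  · rcases lt_or_gt_of_ne hr with h | h
    · simp [rq_of_neg p (mul_neg_of_pos_of_neg hf h)]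
    · simp [rq_of_neg p (neg_lt_zero.2 (mul_pos hf h))]

/-! ### The limiting case of Bailey's lemma -/

lemma altSum_of_neg (e M N : ℤ) (h : M + N < 0) : altSum p y f e M N = 0 := by
  rw [altSum]
  refine (tsum_congr fun r => ?_).trans tsum_zero
  rcases lt_or_ge (M - f * r) 0 with h1 | h1
  · simp [rq_of_neg p h1]
  · simp [rq_of_neg p (show N + f * r < 0 by omega)]

/-- After the shift `n ↦ n + fr` the sum over `n` is a Durfee sum with offset `2fr + d`. The
leftover `p^{f²r² + dfr}` is `y^{4r² + dgr}` because `fg = 4`, and `3 + 4 = 7` gives the theta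
exponent. -/
theorem tsum_altSum (hp0 : p ≠ 0) (hp : ‖p‖ < 1) (hy0 : y ≠ 0) (hy : ‖y‖ < 1)
    (hpy : p ^ f = y ^ g) (hfg : f * g = 4) (e d : ℤ) :
    ∑' n : ℤ, p ^ (n ^ 2 + d * n) * altSum p y f e n (n + d) =
      theta y (e + d * g) * (qPochInf p p)⁻¹ := by
  obtain ⟨C, hC, hb⟩ := exists_norm_rq_le hp
  let T : ℤ → ℤ → ℂ := fun n r => p ^ (n ^ 2 + d * n) *
    ((-1) ^ r * y ^ (3 * r ^ 2 + e * r) * (rq p (n - f * r) * rq p (n + d + f * r)))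
  have hs : Summable (Function.uncurry T) := by
    have h := (Summable.mul_of_nonneg (summable_norm_sq_add_mul hp0 hp d)
      (summable_norm_cubic_weight hy0 hy e) (fun _ => norm_nonneg _)
      (fun _ => norm_nonneg _)).mul_right (C * C)
    refine Summable.of_norm_bounded h fun x => ?_
    simp only [Function.uncurry, T]
    rw [norm_mul, norm_mul _ (rq p _ * rq p _), norm_mul (rq p _), mul_assoc]
    gcongr <;> exact hb _
  have h1 : ∑' n : ℤ, p ^ (n ^ 2 + d * n) * altSum p y f e n (n + d) = ∑' n, ∑' r, T n r := by
    refine tsum_congr fun n => ?_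
    rw [altSum, ← tsum_mul_left]
  rw [h1, ← hs.tsum_comm, theta, ← tsum_mul_right]
  refine tsum_congr fun r => ?_
  rw [← durfee_eq hp0 hp (2 * (f * r) + d), durfee, ← tsum_mul_left,
    ← (Equiv.addRight (f * r)).tsum_eq]
  refine tsum_congr fun n => ?_
  simp only [Equiv.coe_addRight, T]
  have e1 : p ^ ((n + f * r) ^ 2 + d * (n + f * r)) = p ^ (n ^ 2 + (2 * (f * r) + d) * n) *
      y ^ (4 * r ^ 2 + d * g * r) := by
    rw [show 4 * r ^ 2 + d * g * r = g * (f * r ^ 2 + d * r) by rw [← hfg]; ring, zpow_mul y,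
      ← hpy, ← zpow_mul, ← zpow_add₀ hp0]
    congr 1
    ring
  rw [e1, show 7 * r ^ 2 + (e + d * g) * r = (3 * r ^ 2 + e * r) + (4 * r ^ 2 + d * g * r) by ring,
    zpow_add₀ hy0 (3 * r ^ 2 + e * r), add_sub_cancel_right,
    show n + f * r + d + f * r = n + (2 * (f * r) + d) by ring]
  ring

/-- The sum over `ℤ` in `tsum_altSum` runs over `ℕ` only. -/
theorem tsum_nat_altSum (hp0 : p ≠ 0) (hp : ‖p‖ < 1) (hy0 : y ≠ 0) (hy : ‖y‖ < 1)
    (hpy : p ^ f = y ^ g) (hfg : f * g = 4) (e : ℤ) (d : ℕ)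
    (hd : ∀ n : ℤ, n < 0 → altSum p y f e n (n + d) = 0) :
    ∑' n : ℕ, p ^ (n ^ 2 + d * n) * altSum p y f e n (n + d) =
      theta y (e + d * g) * (qPochInf p p)⁻¹ := by
  rw [← tsum_altSum hp0 hp hy0 hy hpy hfg e d,
    ← (Nat.cast_injective (R := ℤ)).tsum_eq fun n hn => ?_]
  · refine tsum_congr fun n => ?_
    norm_cast
  · rcases lt_or_ge n 0 with h | h
    · simp [hd n h] at hn
    · exact ⟨n.toNat, by omega⟩

end altSum

/-! ### Closed forms: the pairs behind the Rogers–Selberg identities -/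

section RogersSelberg

variable {y : ℂ}

lemma norm_pow_lt_one {y : ℂ} (hy : ‖y‖ < 1) {n : ℕ} (hn : n ≠ 0) : ‖y ^ n‖ < 1 := by
  rw [norm_pow]; exact pow_lt_one₀ (norm_nonneg _) hy hn

/-- The correction term has `e = 1 - 4 = -3` and is antisymmetric under reindexing, hence zero. -/
lemma altSum_self_eq_succ_left (hy0 : y ≠ 0) (hy : ‖y‖ < 1) (n : ℤ) :
    altSum (y ^ 4) y 1 1 n n = altSum (y ^ 4) y 1 1 (n + 1) n := by
  have h := altSum_sub_left (f := 1) (g := 4) (pow_ne_zero 4 hy0)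
    (norm_pow_lt_one hy four_ne_zero) hy0 hy (by norm_cast; simp) 1 (n + 1) n
  have h0 : altSum (y ^ 4) y 1 (-3) (n + 1) n = 0 := by
    have h1 := altSum_neg (p := y ^ 4) (y := y) (f := 1) 3 (n + 1) n
    have h2 := altSum_shift (p := y ^ 4) (y := y) (f := 1) hy0 3 n (n + 1)
    norm_num at h2
    rw [← h1] at h2
    exact self_eq_neg.1 h2
  rw [add_sub_cancel_right, show (1 : ℤ) - 4 = -3 by norm_num, h0, mul_zero, sub_zero] at h
  exact h

/-- The correction term has `e = 5`; shift and reflection turn it into `-y^{-2}` times the sum with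
`e = 1`. -/
lemma altSum_self_eq_succ_right (hy0 : y ≠ 0) (hy : ‖y‖ < 1) (n : ℤ) :
    altSum (y ^ 4) y 1 1 n n = (1 + y ^ (4 * n + 2)) * altSum (y ^ 4) y 1 1 n (n + 1) := by
  have h := altSum_sub_right (f := 1) (g := 4) (pow_ne_zero 4 hy0)
    (norm_pow_lt_one hy four_ne_zero) hy0 hy (by norm_cast; simp) 1 n (n + 1)
  have h2 := altSum_shift (p := y ^ 4) (y := y) (f := 1) hy0 5 n (n + 1)
  have h1 := altSum_neg (p := y ^ 4) (y := y) (f := 1) 1 (n + 1) n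
  norm_num at h h2
  rw [h1] at h2
  have h4 : y ^ (4 * (n + 1)) = (y ^ 4) ^ (n + 1) := by rw [zpow_mul]; norm_cast
  have h5 : y ^ (-2 : ℤ) = (y ^ 2)⁻¹ := by rw [zpow_neg]; norm_cast
  rw [h, h2, show 4 * n + 2 = 4 * (n + 1) + (-2) by ring, zpow_add₀ hy0, h4, h5]
  ring

/-- The sum with `e = -3` at `(n + 1, n + 1)` enters here; the vanishing one at `(n + 1, n)` shows
that it is `y^{4(n+1)}` times the sum with `e = 1`. -/
lemma altSum_succ_right_eq (hy0 : y ≠ 0) (hy : ‖y‖ < 1) (n : ℤ) :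
    altSum (y ^ 4) y 1 1 n (n + 1) =
      (1 - y ^ (8 * (n + 1))) * altSum (y ^ 4) y 1 1 (n + 1) (n + 1) := by
  have h := altSum_sub_left (f := 1) (g := 4) (pow_ne_zero 4 hy0)
    (norm_pow_lt_one hy four_ne_zero) hy0 hy (by norm_cast; simp) 1 (n + 1) (n + 1)
  have h3 := altSum_sub_right (f := 1) (g := 4) (pow_ne_zero 4 hy0)
    (norm_pow_lt_one hy four_ne_zero) hy0 hy (by norm_cast; simp) (-3) (n + 1) (n + 1)
  have h0 : altSum (y ^ 4) y 1 (-3) (n + 1) n = 0 := by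
    have h1 := altSum_neg (p := y ^ 4) (y := y) (f := 1) 3 (n + 1) n
    have h2 := altSum_shift (p := y ^ 4) (y := y) (f := 1) hy0 3 n (n + 1)
    norm_num at h2
    rw [← h1] at h2
    exact self_eq_neg.1 h2
  norm_num at h h3
  rw [h0] at h3
  rw [h, sub_eq_zero.1 h3.symm, show 8 * (n + 1) = 4 * (n + 1) + 4 * (n + 1) by ring,
    zpow_add₀ hy0, zpow_mul]
  norm_cast
  ring

lemma eq_inv_of_inv_eq_mul {A B c : ℂ} (hc : c ≠ 0) (h : A⁻¹ = c * B) : B = (A * c)⁻¹ := by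
  rw [mul_inv, h, mul_comm c B, mul_assoc, mul_inv_cancel₀ hc, mul_one]

/-- The two relations climb the staircase `(n, n) → (n, n + 1) → (n + 1, n + 1)` from the value 1 at
`(0, 0)`. -/
theorem altSum_rogersSelberg (hy0 : y ≠ 0) (hy : ‖y‖ < 1) (n : ℕ) :
    altSum (y ^ 4) y 1 1 n n = (qPoch (y ^ 8) (y ^ 8) n * qPoch (-y ^ 2) (y ^ 4) n)⁻¹ ∧
    altSum (y ^ 4) y 1 1 n (n + 1) =
      (qPoch (y ^ 8) (y ^ 8) n * qPoch (-y ^ 2) (y ^ 4) (n + 1))⁻¹ := by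
  have h2 : ‖-y ^ 2‖ < 1 := by rw [norm_neg]; exact norm_pow_lt_one hy two_ne_zero
  have h4 : ‖y ^ 4‖ < 1 := norm_pow_lt_one hy four_ne_zero
  have h8 : ‖y ^ 8‖ < 1 := norm_pow_lt_one hy (by norm_num)
  have key : ∀ n : ℕ, altSum (y ^ 4) y 1 1 n n =
      (qPoch (y ^ 8) (y ^ 8) n * qPoch (-y ^ 2) (y ^ 4) n)⁻¹ → altSum (y ^ 4) y 1 1 n (n + 1) =
      (qPoch (y ^ 8) (y ^ 8) n * qPoch (-y ^ 2) (y ^ 4) (n + 1))⁻¹ := by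
    intro n h
    have hr := altSum_self_eq_succ_right hy0 hy n
    have hne := one_sub_ne_zero_of_norm (norm_mul_pow_lt_one h2 h4 n)
    have e1 : 1 + y ^ (4 * (n : ℤ) + 2) = 1 - -y ^ 2 * (y ^ 4) ^ n := by
      rw [← pow_mul]; norm_cast; rw [pow_add]; ring
    rw [h, e1] at hr
    rw [qPoch_succ, ← mul_assoc]
    exact eq_inv_of_inv_eq_mul hne hr
  have main : altSum (y ^ 4) y 1 1 n n =
      (qPoch (y ^ 8) (y ^ 8) n * qPoch (-y ^ 2) (y ^ 4) n)⁻¹ := by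
    induction n with
    | zero => simpa using altSum_zero_zero (y ^ 4) y one_pos 1
    | succ n ih =>
      have hr := altSum_succ_right_eq hy0 hy n
      have hne := one_sub_ne_zero_of_norm (norm_mul_pow_lt_one h8 h8 n)
      have e1 : 1 - y ^ (8 * ((n : ℤ) + 1)) = 1 - y ^ 8 * (y ^ 8) ^ n := by
        rw [← pow_mul]; norm_cast; rw [mul_add, pow_add]; ring
      rw [key n ih, e1] at hr
      push_cast
      rw [qPoch_succ (y ^ 8)]
      rw [eq_inv_of_inv_eq_mul hne hr, mul_right_comm]
  exact ⟨main, key n main⟩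

end RogersSelberg

section

variable {y : ℂ}

/-! ### Closed forms: the pairs behind Rogers' identities modulo 14 -/

lemma altSum_succ_eq_add_two (hy0 : y ≠ 0) (hy : ‖y‖ < 1) (n : ℤ) :
    altSum y y 2 1 n (n + 1) = altSum y y 2 1 n (n + 2) ∧
      altSum y y 2 3 n (n + 2) = 0 := by
  have h := altSum_sub_right (f := 2) (g := 2) hy0 hy hy0 hy rfl 1 n (n + 2)
  have h0 : altSum y y 2 3 n (n + 2) = 0 := by
    have h1 := altSum_neg (p := y) (y := y) (f := 2) 3 (n + 2) n
    have h2 := altSum_shift (p := y) (y := y) (f := 2) hy0 3 n (n + 2)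
    norm_num at h2
    rw [h1] at h2
    exact self_eq_neg.1 h2
  rw [show n + 2 - 1 = n + 1 by ring, show (1 : ℤ) + 2 = 3 by norm_num, h0, mul_zero,
    sub_zero] at h
  exact ⟨h, h0⟩

lemma altSum_self_eq_mul_succ (hy0 : y ≠ 0) (hy : ‖y‖ < 1) (n : ℤ) :
    altSum y y 2 1 n n = (1 - y ^ (2 * n + 1)) * altSum y y 2 1 n (n + 1) := by
  obtain ⟨h, h0⟩ := altSum_succ_eq_add_two hy0 hy n
  have h1 := altSum_sub_right (f := 2) (g := 2) hy0 hy hy0 hy rfl 1 n (n + 1)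
  have h2 := altSum_sub_right (f := 2) (g := 2) hy0 hy hy0 hy rfl 3 n (n + 2)
  have h3 := altSum_shift (p := y) (y := y) (f := 2) hy0 5 n (n + 2)
  have h4 := altSum_neg (p := y) (y := y) (f := 2) 1 (n + 2) n
  rw [add_sub_cancel_right, show (1 : ℤ) + 2 = 3 by norm_num] at h1
  rw [show n + 2 - 1 = n + 1 by ring, show (3 : ℤ) + 2 = 5 by norm_num, h0] at h2
  rw [show (5 : ℤ) - 6 = -1 by norm_num, add_sub_cancel_right, h4, ← h,
    show (3 : ℤ) - 5 = -2 by norm_num] at h3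
  have e : y ^ (2 * n + 1) = y ^ (n + 1) * y ^ (n + 2) * y ^ (-2 : ℤ) := by
    rw [← zpow_add₀ hy0, ← zpow_add₀ hy0]
    congr 1
    ring
  rw [h1, h2, h3, e]
  ring

lemma altSum_succ_eq_mul (hy0 : y ≠ 0) (hy : ‖y‖ < 1) (n : ℤ) :
    altSum y y 2 1 n (n + 1) = (1 - y ^ (n + 1)) * altSum y y 2 1 (n + 1) (n + 1) := by
  have h := altSum_sub_left (f := 2) (g := 2) hy0 hy hy0 hy rfl 1 (n + 1) (n + 1)
  rw [add_sub_cancel_right, show (1 : ℤ) - 2 = -1 by norm_num, altSum_neg] at h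
  rw [h]
  ring

theorem altSum_rogers (hy0 : y ≠ 0) (hy : ‖y‖ < 1) (n : ℕ) :
    altSum y y 2 1 n n = (qPoch y y n * qPoch y (y ^ 2) n)⁻¹ ∧
    altSum y y 2 1 n (n + 1) = (qPoch y y n * qPoch y (y ^ 2) (n + 1))⁻¹ := by
  have h2 : ‖y ^ 2‖ < 1 := norm_pow_lt_one hy two_ne_zero
  have key : ∀ n : ℕ, altSum y y 2 1 n n = (qPoch y y n * qPoch y (y ^ 2) n)⁻¹ →
      altSum y y 2 1 n (n + 1) = (qPoch y y n * qPoch y (y ^ 2) (n + 1))⁻¹ := by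
    intro n h
    have hr := altSum_self_eq_mul_succ hy0 hy n
    have hne := one_sub_ne_zero_of_norm (norm_mul_pow_lt_one hy h2 n)
    have e1 : 1 - y ^ (2 * (n : ℤ) + 1) = 1 - y * (y ^ 2) ^ n := by
      rw [← pow_mul]; norm_cast; rw [pow_succ']
    rw [h, e1] at hr
    rw [qPoch_succ y (y ^ 2), ← mul_assoc]
    exact eq_inv_of_inv_eq_mul hne hr
  have main : altSum y y 2 1 n n = (qPoch y y n * qPoch y (y ^ 2) n)⁻¹ := by
    induction n with
    | zero => simpa using altSum_zero_zero y y two_pos 1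
    | succ n ih =>
      have hr := altSum_succ_eq_mul hy0 hy n
      have hne := one_sub_ne_zero_of_norm (norm_mul_pow_lt_one hy hy n)
      have e1 : 1 - y ^ ((n : ℤ) + 1) = 1 - y * y ^ n := by
        norm_cast; rw [pow_succ']
      rw [key n ih, e1] at hr
      push_cast
      rw [qPoch_succ y y, eq_inv_of_inv_eq_mul hne hr, mul_right_comm]
  exact ⟨main, key n main⟩

/-! ### The Rogers–Selberg identities, with `y²` for `q` -/

theorem rogers_selberg_one (hy0 : y ≠ 0) (hy : ‖y‖ < 1) :
    ∑' n : ℕ, (y ^ 4) ^ (n ^ 2) * (qPoch (y ^ 8) (y ^ 8) n * qPoch (-y ^ 2) (y ^ 4) n)⁻¹ =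
      Jpair y 6 14 * (qPochInf (y ^ 4) (y ^ 4))⁻¹ := by
  have h := tsum_nat_altSum (f := 1) (g := 4) (pow_ne_zero 4 hy0) (norm_pow_lt_one hy four_ne_zero)
    hy0 hy (by norm_cast; simp) (by norm_num) 1 0 fun n hn => altSum_of_neg _ _ _ (by simp; omega)
  have ht := theta_eq_Jpair hy0 hy (a := 1) (by norm_num)
  norm_num at h ht
  rw [← ht, ← h]
  exact tsum_congr fun n => by rw [(altSum_rogersSelberg hy0 hy n).1, mul_inv]

theorem rogers_selberg_two (hy0 : y ≠ 0) (hy : ‖y‖ < 1) :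
    ∑' n : ℕ, (y ^ 4) ^ (n ^ 2 + n) * (qPoch (y ^ 8) (y ^ 8) n * qPoch (-y ^ 2) (y ^ 4) n)⁻¹ =
      Jpair y 4 14 * (qPochInf (y ^ 4) (y ^ 4))⁻¹ := by
  have h := tsum_nat_altSum (f := 1) (g := 4) (pow_ne_zero 4 hy0) (norm_pow_lt_one hy four_ne_zero)
    -- With `e = -1`, `d = 1`, `g = 4` the theta index `e + dg` is 3.
    hy0 hy (by norm_cast; simp) (by norm_num) (-1) 1
    fun n hn => altSum_of_neg _ _ _ (by simp; omega)
  have ht := theta_eq_Jpair hy0 hy (a := 3) (by norm_num)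
  norm_num at h ht
  rw [← ht, ← h]
  refine tsum_congr fun n => ?_
  rw [altSum_neg, ← altSum_self_eq_succ_left hy0 hy, (altSum_rogersSelberg hy0 hy n).1, mul_inv]

theorem rogers_selberg_three (hy0 : y ≠ 0) (hy : ‖y‖ < 1) :
    ∑' n : ℕ, (y ^ 4) ^ (n ^ 2 + n) *
        (qPoch (y ^ 8) (y ^ 8) n * qPoch (-y ^ 2) (y ^ 4) (n + 1))⁻¹ =
      Jpair y 2 14 * (qPochInf (y ^ 4) (y ^ 4))⁻¹ := by
  have h := tsum_nat_altSum (f := 1) (g := 4) (pow_ne_zero 4 hy0) (norm_pow_lt_one hy four_ne_zero)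
    hy0 hy (by norm_cast; simp) (by norm_num) 1 1 fun n hn => altSum_of_neg _ _ _ (by simp; omega)
  have ht := theta_eq_Jpair hy0 hy (a := 5) (by norm_num)
  norm_num at h ht
  rw [← ht, ← h]
  exact tsum_congr fun n => by rw [(altSum_rogersSelberg hy0 hy n).2, mul_inv]

/-! ### Rogers' identities modulo 14 -/

theorem rogers_fourteen_one (hy0 : y ≠ 0) (hy : ‖y‖ < 1) :
    ∑' n : ℕ, y ^ (n ^ 2) * (qPoch y y n * qPoch y (y ^ 2) n)⁻¹ =
      Jpair y 6 14 * (qPochInf y y)⁻¹ := by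
  have h := tsum_nat_altSum (f := 2) (g := 2) hy0 hy hy0 hy rfl (by norm_num) 1 0
    fun n hn => altSum_of_neg _ _ _ (by simp; omega)
  have ht := theta_eq_Jpair hy0 hy (a := 1) (by norm_num)
  norm_num at h ht
  rw [← ht, ← h]
  exact tsum_congr fun n => by rw [(altSum_rogers hy0 hy n).1, mul_inv]

theorem rogers_fourteen_two (hy0 : y ≠ 0) (hy : ‖y‖ < 1) :
    ∑' n : ℕ, y ^ (n ^ 2 + n) * (qPoch y y n * qPoch y (y ^ 2) (n + 1))⁻¹ =
      Jpair y 4 14 * (qPochInf y y)⁻¹ := by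
  have h := tsum_nat_altSum (f := 2) (g := 2) hy0 hy hy0 hy rfl (by norm_num) 1 1
    fun n hn => altSum_of_neg _ _ _ (by simp; omega)
  have ht := theta_eq_Jpair hy0 hy (a := 3) (by norm_num)
  norm_num at h ht
  rw [← ht, ← h]
  exact tsum_congr fun n => by rw [(altSum_rogers hy0 hy n).2, mul_inv]

theorem rogers_fourteen_three (hy0 : y ≠ 0) (hy : ‖y‖ < 1) :
    ∑' n : ℕ, y ^ (n ^ 2 + 2 * n) * (qPoch y y n * qPoch y (y ^ 2) (n + 1))⁻¹ =
      Jpair y 2 14 * (qPochInf y y)⁻¹ := by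
  have h := tsum_nat_altSum (f := 2) (g := 2) hy0 hy hy0 hy rfl (by norm_num) 1 2
    -- At `n = -1` the indices `n` and `n + 2` add up to 0, so `altSum_of_neg` applies only after
    -- replacing `n + 2` by `n + 1`.
    fun n hn => (altSum_succ_eq_add_two hy0 hy n).1.symm.trans (altSum_of_neg _ _ _ (by omega))
  have ht := theta_eq_Jpair hy0 hy (a := 5) (by norm_num)
  norm_num at h ht
  rw [← ht, ← h]
  refine tsum_congr fun n => ?_
  rw [← (altSum_succ_eq_add_two hy0 hy n).1, (altSum_rogers hy0 hy n).2, mul_inv]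

end

/-! ### Absolute convergence of the quadruple series -/

lemma termF_eq (u v w t q : ℂ) (n : ℕ × ℕ × ℕ × ℕ) :
    termF u v w t q n = u ^ n.1 * v ^ n.2.1 * w ^ n.2.2.1 * t ^ n.2.2.2 *
      q ^ ((n.1 : ℤ) ^ 2 + (n.2.1 : ℤ) ^ 2 + (n.2.2.1 : ℤ) ^ 2 + (n.2.2.2 : ℤ) ^ 2 +
        ((n.1 : ℤ) - (n.2.1 : ℤ) - (n.2.2.1 : ℤ)) * (n.2.2.2 : ℤ)) *
      (rq (q ^ 2) n.1 * rq (q ^ 2) n.2.1 * rq (q ^ 2) n.2.2.1 * rq (q ^ 2) n.2.2.2) := by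
  simp only [termF, rq_natCast, div_eq_mul_inv, mul_inv]

/-- The quadratic form is positive definite with least eigenvalue `1 - √3/2 > 1/8`, so an eighth of
the sum of squares bounds it below. -/
lemma norm_zpow_form_le {q : ℂ} {s : ℝ} (hs0 : 0 ≤ s) (hs : s ≤ 1) (hqs : ‖q‖ = s ^ 8)
    (i j k l : ℕ) :
    ‖q ^ ((i : ℤ) ^ 2 + (j : ℤ) ^ 2 + (k : ℤ) ^ 2 + (l : ℤ) ^ 2 +
      ((i : ℤ) - (j : ℤ) - (k : ℤ)) * (l : ℤ))‖ ≤
      s ^ (i ^ 2) * (s ^ (j ^ 2) * (s ^ (k ^ 2) * s ^ (l ^ 2))) := by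
  set E : ℤ := (i : ℤ) ^ 2 + (j : ℤ) ^ 2 + (k : ℤ) ^ 2 + (l : ℤ) ^ 2 +
      ((i : ℤ) - (j : ℤ) - (k : ℤ)) * (l : ℤ) with hE
  have h : (i : ℤ) ^ 2 + (j : ℤ) ^ 2 + (k : ℤ) ^ 2 + (l : ℤ) ^ 2 ≤ 8 * E := by
    rw [hE]
    nlinarith [sq_nonneg (7 * (i : ℤ) + 4 * l), sq_nonneg (7 * (j : ℤ) - 4 * l),
      sq_nonneg (7 * (k : ℤ) - 4 * l), sq_nonneg (l : ℤ)]
  have h0 : 0 ≤ E := by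
    have : 0 ≤ (i : ℤ) ^ 2 + (j : ℤ) ^ 2 + (k : ℤ) ^ 2 + (l : ℤ) ^ 2 := by positivity
    omega
  clear_value E
  lift E to ℕ using h0
  rw [zpow_natCast, norm_pow, hqs, ← pow_mul, ← pow_add, ← pow_add, ← pow_add]
  refine pow_le_pow_of_le_one hs0 hs ?_
  have h' : i ^ 2 + j ^ 2 + k ^ 2 + l ^ 2 ≤ 8 * E := by exact_mod_cast h
  omega

theorem summable_termF (u v w t : ℂ) {q : ℂ} (hq : ‖q‖ < 1) : Summable (termF u v w t q) := by
  obtain ⟨C, hC, hb⟩ := exists_norm_rq_le (norm_sq_lt_one hq)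
  set s : ℝ := ‖q‖ ^ (1 / 8 : ℝ) with hsdef
  have hs0 : 0 ≤ s := by positivity
  have hs : s < 1 := Real.rpow_lt_one (norm_nonneg _) hq (by norm_num)
  have hqs : ‖q‖ = s ^ 8 := by
    rw [hsdef, ← Real.rpow_natCast, ← Real.rpow_mul (norm_nonneg _)]; norm_num
  have hf := fun z : ℂ => (summable_pow_mul_pow_sq ‖z‖ hs0 hs).mul_right C
  have hn : ∀ z : ℂ, 0 ≤ fun i : ℕ => |‖z‖| ^ i * s ^ (i ^ 2) * C := fun z i => by positivity
  have hsum := (hf u).mul_of_nonneg ((hf v).mul_of_nonneg ((hf w).mul_of_nonneg (hf t) (hn w)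
    (hn t)) (hn v) (fun x => mul_nonneg (hn w _) (hn t _))) (hn u)
    (fun x => mul_nonneg (hn v _) (mul_nonneg (hn w _) (hn t _)))
  refine Summable.of_norm_bounded hsum fun n => ?_
  obtain ⟨i, j, k, l⟩ := n
  have h1 := norm_zpow_form_le hs0 hs.le hqs i j k l
  rw [termF_eq]
  simp only [norm_mul, norm_pow, abs_norm]
  calc _ ≤ ‖u‖ ^ i * ‖v‖ ^ j * ‖w‖ ^ k * ‖t‖ ^ l *
        (s ^ (i ^ 2) * (s ^ (j ^ 2) * (s ^ (k ^ 2) * s ^ (l ^ 2)))) * (C * C * C * C) := by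
        gcongr <;> exact hb _
    _ = _ := by ring

theorem F_swap (u v w t q : ℂ) : F u v w t q = F u w v t q := by
  let e : ℕ × ℕ × ℕ × ℕ ≃ ℕ × ℕ × ℕ × ℕ :=
    { toFun := fun x => (x.1, x.2.2.1, x.2.1, x.2.2.2)
      invFun := fun x => (x.1, x.2.2.1, x.2.1, x.2.2.2)
      left_inv := fun x => by simp
      right_inv := fun x => by simp }
  rw [F, ← e.tsum_eq, F]
  refine tsum_congr fun n => ?_
  rw [termF_eq, termF_eq]
  simp only [e, Equiv.coe_fn_mk]
  rw [show ∀ i j k l : ℤ, i ^ 2 + k ^ 2 + j ^ 2 + l ^ 2 + (i - k - j) * l =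
    i ^ 2 + j ^ 2 + k ^ 2 + l ^ 2 + (i - j - k) * l from fun i j k l => by ring]
  ring

/-! ### Reduction to a single sum -/

/-- The general term, after summation over `i, j, k`, of `F(u, v, w, t; q²)`. -/
noncomputable def singleTerm (u v w t q : ℂ) (l : ℕ) : ℂ :=
  t ^ l * q ^ (l ^ 2) * (qPoch (q ^ 2) (q ^ 2) l)⁻¹ *
    (qPochInf (-(u * q ^ l * q)) (q ^ 2) * (qPochInf (-(v * (q ^ l)⁻¹ * q)) (q ^ 2) *
      qPochInf (-(w * (q ^ l)⁻¹ * q)) (q ^ 2)))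

theorem summable_singleTerm_and_F_eq (u v w t : ℂ) {q : ℂ} (hq0 : q ≠ 0) (hq : ‖q‖ < 1) :
    Summable (singleTerm u v w t q) ∧ F u v w t q = ∑' l, singleTerm u v w t q l := by
  let e : ℕ × ℕ × ℕ × ℕ ≃ ℕ × ℕ × ℕ × ℕ :=
    { toFun := fun x => (x.2.1, x.2.2.1, x.2.2.2, x.1)
      invFun := fun x => (x.2.2.2, x.1, x.2.1, x.2.2.1)
      left_inv := fun x => by simp
      right_inv := fun x => by simp }
  have hs := (e.summable_iff).2 (summable_termF u v w t hq)
  have hp := norm_sq_lt_one hq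
  have hin : ∀ l, ∑' x : ℕ × ℕ × ℕ, (termF u v w t q ∘ e) (l, x) = singleTerm u v w t q l := by
    intro l
    have ha := fun z => summable_norm_euler z hq hp
    rw [singleTerm, ← tsum_euler _ hq, ← tsum_euler _ hq, ← tsum_euler _ hq,
      tsum_mul_tsum_of_summable_norm (ha _) (ha _),
      tsum_mul_tsum_of_summable_norm (ha _) ((ha _).mul_norm (ha _)), ← tsum_mul_left]
    refine tsum_congr fun x => ?_
    obtain ⟨i, j, k⟩ := x
    simp only [Function.comp_apply, e, Equiv.coe_fn_mk, termF_eq, ← rq_natCast]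
    have h1 : q ^ ((i : ℤ) ^ 2 + (j : ℤ) ^ 2 + (k : ℤ) ^ 2 + (l : ℤ) ^ 2 +
        ((i : ℤ) - (j : ℤ) - (k : ℤ)) * (l : ℤ)) = q ^ (i ^ 2) * q ^ (j ^ 2) * q ^ (k ^ 2) *
          q ^ (l ^ 2) * ((q ^ l) ^ i * ((q ^ l)⁻¹) ^ j * ((q ^ l)⁻¹) ^ k) := by
      simp only [← zpow_natCast, ← zpow_neg, ← zpow_mul, ← zpow_add₀ hq0]
      congr 1
      push_cast
      ring
    rw [h1]
    ring
  refine ⟨hs.prod.congr fun l => hin l, ?_⟩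
  rw [F, ← e.tsum_eq]
  exact hs.tsum_prod.trans (tsum_congr hin)

theorem F_eq_even_add_odd (u v w t : ℂ) {q : ℂ} (hq0 : q ≠ 0) (hq : ‖q‖ < 1) :
    F u v w t q = ∑' m, singleTerm u v w t q (2 * m) + ∑' m, singleTerm u v w t q (2 * m + 1) := by
  obtain ⟨h1, h2⟩ := summable_singleTerm_and_F_eq u v w t hq0 hq
  rw [h2, tsum_even_add_odd]
  · exact h1.comp_injective fun a b h => by simpa using h
  · exact h1.comp_injective fun a b h => by simpa using h

/-! ### Shifts and factorizations of products -/

/-- Each of the `m` extra factors is reversed: `1 + b q^{-2k} = b q^{-2k} (1 + q^{2k} b⁻¹)` for `1 ≤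
k ≤ m`. -/
lemma qPochInf_neg_mul_inv_pow {b q : ℂ} (hb : b ≠ 0) (hq0 : q ≠ 0) (hq : ‖q‖ < 1) (m : ℕ) :
    qPochInf (-(b * (q ^ (2 * m))⁻¹)) (q ^ 2) =
      b ^ m * (q ^ (m ^ 2 + m))⁻¹ * qPoch (-(q ^ 2 * b⁻¹)) (q ^ 2) m * qPochInf (-b) (q ^ 2) := by
  induction m with
  | zero => simp
  | succ m ih =>
    rw [qPochInf_eq_one_sub_mul _ (norm_sq_lt_one hq)]
    have h1 : -(b * (q ^ (2 * (m + 1)))⁻¹) * q ^ 2 = -(b * (q ^ (2 * m))⁻¹) := by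
      rw [mul_add, pow_add, mul_inv]
      field_simp
    have h2 : q ^ ((m + 1) ^ 2 + (m + 1)) = q ^ (m ^ 2 + m) * q ^ (2 * (m + 1)) := by
      rw [← pow_add]; ring_nf
    have h3 : -(q ^ 2 * b⁻¹) * (q ^ 2) ^ m = -(q ^ (2 * (m + 1)) * b⁻¹) := by
      rw [← pow_mul, mul_add, pow_add]; ring
    rw [h1, ih, qPoch_succ, h2, h3, pow_succ]
    have := pow_ne_zero (2 * (m + 1)) hq0
    have := pow_ne_zero (m ^ 2 + m) hq0
    field_simp
    ring

lemma qPoch_two_mul (p : ℂ) (m : ℕ) :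
    qPoch p p (2 * m) = qPoch p (p ^ 2) m * qPoch (p ^ 2) (p ^ 2) m := by
  induction m with
  | zero => simp
  | succ m ih =>
    rw [show 2 * (m + 1) = 2 * m + 1 + 1 by ring, qPoch_succ, qPoch_succ, ih, qPoch_succ,
      qPoch_succ, ← pow_mul]
    ring

lemma qPoch_two_mul_add_one (p : ℂ) (m : ℕ) :
    qPoch p p (2 * m + 1) = qPoch p (p ^ 2) (m + 1) * qPoch (p ^ 2) (p ^ 2) m := by
  rw [qPoch_succ, qPoch_two_mul, qPoch_succ p (p ^ 2), ← pow_mul]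
  ring

lemma qPoch_mul_neg (a p : ℂ) (m : ℕ) :
    qPoch a p m * qPoch (-a) p m = qPoch (a ^ 2) (p ^ 2) m := by
  rw [qPoch, qPoch, qPoch, ← Finset.prod_mul_distrib]
  refine Finset.prod_congr rfl fun k _ => ?_
  rw [← pow_mul, mul_comm 2 k, pow_mul]
  ring

lemma qPochInf_neg_inv_pow_mul_self {q : ℂ} (hq0 : q ≠ 0) (hq : ‖q‖ < 1) (m : ℕ) :
    qPochInf (-((q ^ (2 * m))⁻¹ * q)) (q ^ 2) =
      (q ^ (m ^ 2))⁻¹ * qPoch (-q) (q ^ 2) m * qPochInf (-q) (q ^ 2) := by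
  rw [mul_comm _ q, qPochInf_neg_mul_inv_pow hq0 hq0 hq, pow_add, mul_inv, sq q,
    mul_inv_cancel_right₀ hq0]
  have := pow_ne_zero m hq0
  field_simp

lemma qPochInf_neg_one {q : ℂ} (hq : ‖q‖ < 1) :
    qPochInf (-1) (q ^ 2) = 2 * qPochInf (-q ^ 2) (q ^ 2) := by
  rw [qPochInf_eq_one_sub_mul _ (norm_sq_lt_one hq)]
  norm_num

lemma qPochInf_neg_inv_pow {q : ℂ} (hq0 : q ≠ 0) (hq : ‖q‖ < 1) (m : ℕ) :
    qPochInf (-(q ^ (2 * m))⁻¹) (q ^ 2) =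
      (q ^ (m ^ 2 + m))⁻¹ * qPoch (-q ^ 2) (q ^ 2) m * (2 * qPochInf (-q ^ 2) (q ^ 2)) := by
  have := qPochInf_neg_mul_inv_pow one_ne_zero hq0 hq m
  simpa [qPochInf_neg_one hq] using this

section

variable {q : ℂ}

lemma qPoch_sq_two_mul (q : ℂ) (m : ℕ) : qPoch (q ^ 2) (q ^ 2) (2 * m) =
    qPoch q (q ^ 2) m * qPoch (-q) (q ^ 2) m * qPoch (q ^ 4) (q ^ 4) m := by
  rw [qPoch_two_mul, qPoch_mul_neg, ← pow_mul]

lemma qPoch_sq_two_mul_add_one (q : ℂ) (m : ℕ) : qPoch (q ^ 2) (q ^ 2) (2 * m + 1) =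
    qPoch q (q ^ 2) (m + 1) * qPoch (-q) (q ^ 2) (m + 1) * qPoch (q ^ 4) (q ^ 4) m := by
  rw [qPoch_two_mul_add_one, qPoch_mul_neg, ← pow_mul]

lemma qPoch_sq_two_mul' (q : ℂ) (m : ℕ) : qPoch (q ^ 2) (q ^ 2) (2 * m) =
    qPoch (q ^ 2) (q ^ 4) m * (qPoch (q ^ 2) (q ^ 2) m * qPoch (-q ^ 2) (q ^ 2) m) := by
  rw [qPoch_mul_neg, qPoch_two_mul, ← pow_mul]

lemma qPoch_sq_two_mul_add_one' (q : ℂ) (m : ℕ) : qPoch (q ^ 2) (q ^ 2) (2 * m + 1) =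
    qPoch (q ^ 2) (q ^ 4) (m + 1) * (qPoch (q ^ 2) (q ^ 2) m * qPoch (-q ^ 2) (q ^ 2) m) := by
  rw [qPoch_mul_neg, qPoch_two_mul_add_one, ← pow_mul]

lemma norm_neg_lt_one (hq : ‖q‖ < 1) : ‖-q‖ < 1 := by rwa [norm_neg]

lemma qPochInf_neg_pow_mul_self (hq : ‖q‖ < 1) (m : ℕ) :
    qPochInf (-(q ^ (2 * m) * q)) (q ^ 2) =
      (qPoch (-q) (q ^ 2) m)⁻¹ * qPochInf (-q) (q ^ 2) := by
  have hp := norm_sq_lt_one hq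
  rw [← qPoch_mul_qPochInf (-q) hp m, inv_mul_cancel_left₀
    (qPoch_ne_zero_of_norm (norm_neg_lt_one hq) hp m), ← pow_mul]
  congr 1
  ring

lemma qPochInf_neg_pow_mul_sq (hq : ‖q‖ < 1) (m : ℕ) :
    qPochInf (-(q ^ (2 * m) * q ^ 2)) (q ^ 2) =
      (qPoch (-q ^ 2) (q ^ 2) m)⁻¹ * qPochInf (-q ^ 2) (q ^ 2) := by
  have hp := norm_sq_lt_one hq
  rw [← qPoch_mul_qPochInf (-q ^ 2) hp m, inv_mul_cancel_left₀
    (qPoch_ne_zero_of_norm (norm_neg_lt_one hp) hp m), ← pow_mul]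
  congr 1
  ring

/-! ### Even and odd parts of the specialised series -/

theorem F_one_one_one (t : ℂ) (hq0 : q ≠ 0) (hq : ‖q‖ < 1) :
    F 1 1 1 t q =
      qPochInf (-q) (q ^ 2) ^ 3 * ∑' m : ℕ, t ^ (2 * m) * (q ^ 2) ^ (m ^ 2) *
        (qPoch (q ^ 4) (q ^ 4) m * qPoch q (q ^ 2) m)⁻¹ +
      4 * (t * q) * qPochInf (-q ^ 2) (q ^ 2) ^ 3 *
        ∑' m : ℕ, t ^ (2 * m) * (q ^ 2) ^ (m ^ 2 + m) *
          (qPoch (q ^ 2) (q ^ 2) m * qPoch (q ^ 2) (q ^ 4) (m + 1))⁻¹ := by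
  have hp := norm_sq_lt_one hq
  rw [F_eq_even_add_odd _ _ _ _ hq0 hq, ← tsum_mul_left, ← tsum_mul_left]
  congr 1
  · refine tsum_congr fun m => ?_
    have hB := qPoch_ne_zero_of_norm (norm_neg_lt_one hq) hp m
    have hpow : q ^ ((2 * m) ^ 2) = (q ^ 2) ^ (m ^ 2) * (q ^ (m ^ 2)) ^ 2 := by
      rw [← pow_mul, ← pow_mul, ← pow_add]; ring_nf
    have hne := pow_ne_zero (m ^ 2) hq0
    rw [singleTerm, one_mul, one_mul, qPochInf_neg_pow_mul_self hq,
      qPochInf_neg_inv_pow_mul_self hq0 hq, qPoch_sq_two_mul, hpow]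
    simp only [mul_inv]
    field_simp
  -- For odd `l` the products with `v` and `w` each reduce to `(-1; q²)_∞ = 2 (-q²; q²)_∞`, whence
  -- the factor 4.
  · refine tsum_congr fun m => ?_
    have hB := qPoch_ne_zero_of_norm (norm_neg_lt_one hp) hp m
    have hpow : q ^ ((2 * m + 1) ^ 2) = (q ^ 2) ^ (m ^ 2 + m) * (q ^ (m ^ 2 + m)) ^ 2 * q := by
      rw [← pow_mul, ← pow_mul, ← pow_add, ← pow_succ]; ring_nf
    have hne := pow_ne_zero (m ^ 2 + m) hq0
    have h1 : q ^ (2 * m + 1) * q = q ^ (2 * m) * q ^ 2 := by ring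
    have h2 : (q ^ (2 * m + 1))⁻¹ * q = (q ^ (2 * m))⁻¹ := by
      rw [pow_succ, mul_inv, inv_mul_cancel_right₀ hq0]
    rw [singleTerm, one_mul, one_mul, h1, h2, qPochInf_neg_pow_mul_sq hq,
      qPochInf_neg_inv_pow hq0 hq, qPoch_sq_two_mul_add_one', hpow, pow_succ t]
    simp only [mul_inv]
    field_simp
    ring

theorem F_inv_self_inv (hq0 : q ≠ 0) (hq : ‖q‖ < 1) :
    F q⁻¹ q q⁻¹ 1 q =
      4 * qPochInf (-q ^ 2) (q ^ 2) ^ 3 * ∑' m : ℕ, (q ^ 2) ^ (m ^ 2) *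
        (qPoch (q ^ 2) (q ^ 2) m * qPoch (q ^ 2) (q ^ 4) m)⁻¹ +
      qPochInf (-q) (q ^ 2) ^ 3 * ∑' m : ℕ, (q ^ 2) ^ (m ^ 2 + m) *
        (qPoch (q ^ 4) (q ^ 4) m * qPoch q (q ^ 2) (m + 1))⁻¹ := by
  have hp := norm_sq_lt_one hq
  rw [F_eq_even_add_odd _ _ _ _ hq0 hq, ← tsum_mul_left, ← tsum_mul_left]
  congr 1
  · refine tsum_congr fun m => ?_
    have hB := qPoch_ne_zero_of_norm (norm_neg_lt_one hp) hp m
    have hpow : q ^ ((2 * m) ^ 2) * (q ^ 2) ^ m =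
        (q ^ 2) ^ (m ^ 2) * (q ^ (m ^ 2 + m)) ^ 2 := by
      rw [← pow_mul, ← pow_mul, ← pow_mul, ← pow_add, ← pow_add]; ring_nf
    have hne := pow_ne_zero (m ^ 2 + m) hq0
    -- The finite factor `(-1; q²)_m` extracted from the `v` product completes the `u` product to
    -- `(-1; q²)_∞`.
    have hprod : qPochInf (-(q⁻¹ * q ^ (2 * m) * q)) (q ^ 2) *
        qPochInf (-(q * (q ^ (2 * m))⁻¹ * q)) (q ^ 2) =
        2 * (q ^ 2) ^ m * (q ^ (m ^ 2 + m))⁻¹ * qPochInf (-q ^ 2) (q ^ 2) ^ 2 := by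
      have h1 := qPoch_mul_qPochInf (-1) hp m
      rw [qPochInf_neg_one hq, ← pow_mul, neg_one_mul] at h1
      rw [show q⁻¹ * q ^ (2 * m) * q = q ^ (2 * m) by field_simp,
        show q * (q ^ (2 * m))⁻¹ * q = q ^ 2 * (q ^ (2 * m))⁻¹ by ring,
        qPochInf_neg_mul_inv_pow (pow_ne_zero 2 hq0) hq0 hq, mul_inv_cancel₀ (pow_ne_zero 2 hq0)]
      linear_combination (q ^ 2) ^ m * (q ^ (m ^ 2 + m))⁻¹ * qPochInf (-q ^ 2) (q ^ 2) * h1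
    rw [singleTerm, ← mul_assoc (qPochInf _ _), hprod,
      show q⁻¹ * (q ^ (2 * m))⁻¹ * q = (q ^ (2 * m))⁻¹ by field_simp,
      qPochInf_neg_inv_pow hq0 hq, qPoch_sq_two_mul', one_pow, one_mul]
    generalize q ^ ((2 * m) ^ 2) = X at *
    rw [show X = (q ^ 2) ^ (m ^ 2) * (q ^ (m ^ 2 + m)) ^ 2 * ((q ^ 2) ^ m)⁻¹ by
      rw [← hpow, mul_inv_cancel_right₀ (pow_ne_zero _ (pow_ne_zero 2 hq0))]]
    simp only [mul_inv]
    have hne2 := pow_ne_zero m (pow_ne_zero 2 hq0)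
    field_simp
    ring
  · refine tsum_congr fun m => ?_
    have hB := qPoch_ne_zero_of_norm (norm_neg_lt_one hq) hp m
    have hB' := qPoch_ne_zero_of_norm (norm_neg_lt_one hq) hp (m + 1)
    have hpow : q ^ ((2 * m + 1) ^ 2) =
        (q ^ 2) ^ (m ^ 2 + m) * (q ^ (m ^ 2) * q ^ ((m + 1) ^ 2)) := by
      rw [← pow_mul, ← pow_add, ← pow_add]; ring_nf
    have hne := pow_ne_zero (m ^ 2) hq0
    have hne' := pow_ne_zero ((m + 1) ^ 2) hq0
    have h1 : q⁻¹ * q ^ (2 * m + 1) * q = q ^ (2 * m) * q := by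
      rw [pow_succ]; field_simp
    have h2 : q * (q ^ (2 * m + 1))⁻¹ * q = (q ^ (2 * m))⁻¹ * q := by
      rw [pow_succ]; field_simp
    have h3 : q⁻¹ * (q ^ (2 * m + 1))⁻¹ * q = (q ^ (2 * (m + 1)))⁻¹ * q := by
      rw [mul_add, pow_add, pow_add]; field_simp
    rw [singleTerm, h1, h2, h3, qPochInf_neg_pow_mul_self hq,
      qPochInf_neg_inv_pow_mul_self hq0 hq, qPochInf_neg_inv_pow_mul_self hq0 hq,
      qPoch_sq_two_mul_add_one, hpow, one_pow, one_mul]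
    simp only [mul_inv]
    field_simp

/-! ### Evaluation of the products -/

lemma J_ne_zero (hq : ‖q‖ < 1) {m : ℕ} (hm : m ≠ 0) : J q m ≠ 0 :=
  qPochInf_ne_zero_of_norm (norm_pow_lt_one hq hm) (norm_pow_lt_one hq hm)

lemma qPochInf_neg_sq_eq (hq : ‖q‖ < 1) : qPochInf (-q ^ 2) (q ^ 2) = J q 4 / J q 2 := by
  rw [eq_div_iff (J_ne_zero hq two_ne_zero), mul_comm, J,
    qPochInf_mul_neg _ (norm_sq_lt_one hq), J, ← pow_mul]

lemma J_eq_mul (hq : ‖q‖ < 1) : J q 1 = qPochInf q (q ^ 2) * J q 2 := by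
  rw [J, pow_one, qPochInf_dissect q hq two_ne_zero, J]
  simp [Finset.prod_range_succ, sq]

lemma J_pow (q : ℂ) (m n : ℕ) : J (q ^ m) n = J q (m * n) := by
  rw [J, J, pow_mul]

lemma Jpair_pow (q : ℂ) (c a m : ℕ) : Jpair (q ^ c) a m = Jpair q (c * a) (c * m) := by
  rw [Jpair, Jpair, ← Nat.mul_sub]
  simp only [pow_mul]

/-- Here `(q; q²)_∞ (-q; q²)_∞ = (q²; q⁴)_∞ = J_2/J_4`, while `(q; q²)_∞ = J_1/J_2`. -/
lemma qPochInf_neg_eq (hq : ‖q‖ < 1) :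
    qPochInf (-q) (q ^ 2) = J q 2 ^ 2 / (J q 1 * J q 4) := by
  have h1 := J_eq_mul hq
  have h2 := J_eq_mul (norm_sq_lt_one hq)
  have h3 := qPochInf_mul_neg q (norm_sq_lt_one hq)
  rw [J_pow, J_pow, mul_one, ← h3] at h2
  norm_num at h2
  rw [eq_div_iff (mul_ne_zero (J_ne_zero hq one_ne_zero) (J_ne_zero hq four_ne_zero)), h1]
  linear_combination (-J q 2) * h2

end

/-! ### Products by residue modulo 28 -/

section

variable {q : ℂ}

/-- `(q^a; q^28)_∞`. -/
noncomputable def residueProd (q : ℂ) (a : ℕ) : ℂ := qPochInf (q ^ a) (q ^ 28)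

lemma residueProd_ne_zero (hq : ‖q‖ < 1) {a : ℕ} (ha : a ≠ 0) : residueProd q a ≠ 0 :=
  qPochInf_ne_zero_of_norm (norm_pow_lt_one hq ha) (norm_pow_lt_one hq (by norm_num))

lemma qPochInf_pow_fourteen (hq : ‖q‖ < 1) (a : ℕ) :
    qPochInf (q ^ a) (q ^ 14) = residueProd q a * residueProd q (a + 14) := by
  rw [qPochInf_dissect _ (norm_pow_lt_one hq (by norm_num)) two_ne_zero, ← pow_mul]
  simp [Finset.prod_range_succ, residueProd, pow_add]

lemma qPochInf_neg_pow_fourteen (hq : ‖q‖ < 1) {a : ℕ} (ha : a ≠ 0) :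
    qPochInf (-q ^ a) (q ^ 14) =
      residueProd q (2 * a) / (residueProd q a * residueProd q (a + 14)) := by
  rw [eq_div_iff (mul_ne_zero (residueProd_ne_zero hq ha) (residueProd_ne_zero hq (by simp))),
    ← qPochInf_pow_fourteen hq, mul_comm, qPochInf_mul_neg _ (norm_pow_lt_one hq (by norm_num)),
    ← pow_mul, ← pow_mul, residueProd, mul_comm a]

lemma qPochInf_neg_seven (a : ℂ) (hq : ‖q‖ < 1) :
    qPochInf a (-q ^ 7) = qPochInf a (q ^ 14) * qPochInf (-(a * q ^ 7)) (q ^ 14) := by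
  rw [qPochInf_dissect a (norm_neg_lt_one (norm_pow_lt_one hq (by norm_num))) two_ne_zero,
    show (-q ^ 7) ^ 2 = q ^ 14 by ring]
  simp [Finset.prod_range_succ]

lemma J_fourteen_eq (hq : ‖q‖ < 1) : J q 14 = residueProd q 14 * residueProd q 28 :=
  qPochInf_pow_fourteen hq 14

lemma J_two_eq (hq : ‖q‖ < 1) : J q 2 =
    residueProd q 2 * residueProd q 4 * residueProd q 6 * residueProd q 8 * residueProd q 10 *
    residueProd q 12 * residueProd q 14 * residueProd q 16 * residueProd q 18 * residueProd q 20 *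
    residueProd q 22 * residueProd q 24 * residueProd q 26 * residueProd q 28 := by
  rw [J, qPochInf_dissect _ (norm_sq_lt_one hq) (d := 14) (by norm_num)]
  simp only [Finset.prod_range_succ, Finset.prod_range_zero, ← pow_mul, ← pow_add, residueProd]
  norm_num

lemma Jpair_eq (q : ℂ) (a : ℕ) :
    Jpair q a 28 = residueProd q a * residueProd q (28 - a) * residueProd q 28 := rfl

lemma qPochInf_neg_seven_self (hq : ‖q‖ < 1) : qPochInf (-q ^ 7) (-q ^ 7) =
    residueProd q 14 / (residueProd q 7 * residueProd q 21) *
      (residueProd q 14 * residueProd q 28) := by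
  rw [qPochInf_neg_seven _ hq, qPochInf_neg_pow_fourteen hq (by norm_num),
    show -(-q ^ 7 * q ^ 7) = q ^ 14 by ring, qPochInf_pow_fourteen hq]

/-- The theta products modulo 7 with `-q` in place of `q`. -/
lemma Jpair_sqrt_neg {y : ℂ} (hy : y ^ 2 = -q) (hq : ‖q‖ < 1) :
    Jpair y 6 14 * (J q 2)⁻¹ = J q 14 * J q 28 ^ 5 /
      (Jpair q 2 28 * Jpair q 3 28 * Jpair q 7 28 * Jpair q 8 28 * Jpair q 11 28 *
        Jpair q 12 28) ∧
    Jpair y 4 14 * (J q 2)⁻¹ = J q 14 * J q 28 ^ 5 /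
      (Jpair q 4 28 * Jpair q 5 28 * Jpair q 6 28 * Jpair q 7 28 * Jpair q 8 28 *
        Jpair q 9 28) ∧
    Jpair y 2 14 * (J q 2)⁻¹ = J q 14 * J q 28 ^ 5 /
      (Jpair q 1 28 * Jpair q 4 28 * Jpair q 7 28 * Jpair q 10 28 * Jpair q 12 28 *
        Jpair q 13 28) := by
  have hpow : ∀ n, y ^ (2 * n) = (-1) ^ n * q ^ n := fun n => by
    rw [pow_mul, hy, neg_pow]
  have h2 : y ^ 2 = -q ^ 1 := by simpa using hy
  have h4 : y ^ 4 = q ^ 2 := by simpa using hpow 2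
  have h6 : y ^ 6 = -q ^ 3 := by simpa [pow_succ] using hpow 3
  have h8 : y ^ 8 = q ^ 4 := by simpa [pow_succ] using hpow 4
  have h10 : y ^ 10 = -q ^ 5 := by simpa [pow_succ] using hpow 5
  have h12 : y ^ 12 = q ^ 6 := by simpa [pow_succ] using hpow 6
  have h14 : y ^ 14 = -q ^ 7 := by simpa [pow_succ] using hpow 7
  have hn : ∀ a b, qPochInf (-(-q ^ a * q ^ b)) (q ^ 14) = qPochInf (q ^ (a + b)) (q ^ 14) :=
    fun a b => by rw [pow_add, neg_mul, neg_neg]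
  have hR := fun a (ha : a ≠ 0) => residueProd_ne_zero hq ha
  have hJ : J q 28 = residueProd q 28 := rfl
  -- Both sides become quotients of the nonzero `residueProd q a`, and the identities reduce to
  -- cancellation.
  simp only [Jpair_eq, J_fourteen_eq hq, J_two_eq hq, hJ]
  simp only [Jpair, h2, h4, h6, h8, h10, h12, h14, qPochInf_neg_seven_self hq,
    Nat.reduceSub]
  simp only [qPochInf_neg_seven _ hq, hn, ← pow_add]
  simp only [Nat.reduceAdd, qPochInf_pow_fourteen hq,
    qPochInf_neg_pow_fourteen hq (show 1 ≠ 0 by norm_num),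
    qPochInf_neg_pow_fourteen hq (show 3 ≠ 0 by norm_num),
    qPochInf_neg_pow_fourteen hq (show 5 ≠ 0 by norm_num),
    qPochInf_neg_pow_fourteen hq (show 9 ≠ 0 by norm_num),
    qPochInf_neg_pow_fourteen hq (show 11 ≠ 0 by norm_num),
    qPochInf_neg_pow_fourteen hq (show 13 ≠ 0 by norm_num), Nat.reduceMul]
  refine ⟨?_, ?_, ?_⟩ <;> field_simp (disch := exact hR _ (by norm_num))

end

/-! ### The series in terms of `q`, and the case `q = 0` -/

section

variable {q : ℂ}

theorem rogers_selberg_neg (hq0 : q ≠ 0) (hq : ‖q‖ < 1) :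
    ∑' m : ℕ, (q ^ 2) ^ (m ^ 2) * (qPoch (q ^ 4) (q ^ 4) m * qPoch q (q ^ 2) m)⁻¹ =
      J q 14 * J q 28 ^ 5 / (Jpair q 2 28 * Jpair q 3 28 * Jpair q 7 28 * Jpair q 8 28 *
        Jpair q 11 28 * Jpair q 12 28) ∧
    ∑' m : ℕ, (q ^ 2) ^ (m ^ 2 + m) * (qPoch (q ^ 4) (q ^ 4) m * qPoch q (q ^ 2) m)⁻¹ =
      J q 14 * J q 28 ^ 5 / (Jpair q 4 28 * Jpair q 5 28 * Jpair q 6 28 * Jpair q 7 28 *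
        Jpair q 8 28 * Jpair q 9 28) ∧
    ∑' m : ℕ, (q ^ 2) ^ (m ^ 2 + m) * (qPoch (q ^ 4) (q ^ 4) m * qPoch q (q ^ 2) (m + 1))⁻¹ =
      J q 14 * J q 28 ^ 5 / (Jpair q 1 28 * Jpair q 4 28 * Jpair q 7 28 * Jpair q 10 28 *
        Jpair q 12 28 * Jpair q 13 28) := by
  -- A square root `y` of `-q` gives `-y² = q`, `y⁴ = q²` and `y⁸ = q⁴`, the bases of the series.
  obtain ⟨y, hy⟩ := IsAlgClosed.exists_pow_nat_eq (-q) two_pos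
  have hy0 : y ≠ 0 := by
    rintro rfl
    exact hq0 (by simpa using hy.symm)
  have hy1 : ‖y‖ < 1 := by
    have : ‖y‖ ^ 2 < 1 := by rw [← norm_pow, hy, norm_neg]; exact hq
    exact (sq_lt_one_iff₀ (norm_nonneg _)).1 this
  have h4 : y ^ 4 = q ^ 2 := by rw [show y ^ 4 = (y ^ 2) ^ 2 by ring, hy, neg_sq]
  have h8 : y ^ 8 = q ^ 4 := by rw [show y ^ 8 = (y ^ 4) ^ 2 by ring, h4, ← pow_mul]
  obtain ⟨h1, h2, h3⟩ := Jpair_sqrt_neg hy hq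
  rw [← h1, ← h2, ← h3]
  have s1 := rogers_selberg_one hy0 hy1
  have s2 := rogers_selberg_two hy0 hy1
  have s3 := rogers_selberg_three hy0 hy1
  rw [hy, h4, h8, neg_neg] at s1 s2 s3
  exact ⟨s1, s2, s3⟩

theorem rogers_fourteen_sq (hq0 : q ≠ 0) (hq : ‖q‖ < 1) :
    ∑' m : ℕ, (q ^ 2) ^ (m ^ 2) * (qPoch (q ^ 2) (q ^ 2) m * qPoch (q ^ 2) (q ^ 4) m)⁻¹ =
      Jpair q 12 28 / J q 2 ∧
    ∑' m : ℕ, (q ^ 2) ^ (m ^ 2 + m) *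
        (qPoch (q ^ 2) (q ^ 2) m * qPoch (q ^ 2) (q ^ 4) (m + 1))⁻¹ = Jpair q 8 28 / J q 2 ∧
    ∑' m : ℕ, (q ^ 2) ^ (m ^ 2 + 2 * m) *
        (qPoch (q ^ 2) (q ^ 2) m * qPoch (q ^ 2) (q ^ 4) (m + 1))⁻¹ = Jpair q 4 28 / J q 2 := by
  have hp0 := pow_ne_zero 2 hq0
  have hp := norm_sq_lt_one hq
  have s1 := rogers_fourteen_one hp0 hp
  have s2 := rogers_fourteen_two hp0 hp
  have s3 := rogers_fourteen_three hp0 hp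
  rw [Jpair_pow, ← div_eq_mul_inv, ← pow_mul] at s1 s2 s3
  exact ⟨s1, s2, s3⟩

lemma F_zero_right (u v w t : ℂ) : F u v w t 0 = 1 := by
  rw [F, tsum_eq_single (0, 0, 0, 0)]
  · simp [termF]
  · rintro ⟨i, j, k, l⟩ hn
    have h := norm_zpow_form_le (q := 0) (s := 0) le_rfl zero_le_one (by simp) i j k l
    rw [termF_eq, norm_eq_zero.1 (le_antisymm (h.trans_eq ?_) (norm_nonneg _))]
    · simp
    · rw [← pow_add, ← pow_add, ← pow_add]
      refine zero_pow fun h0 => hn ?_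
      simp at h0
      simp [h0]

lemma qPochInf_zero (p : ℂ) : qPochInf 0 p = 1 := by simp [qPochInf]

lemma J_zero {m : ℕ} (hm : m ≠ 0) : J 0 m = 1 := by
  rw [J, zero_pow hm, qPochInf_zero]

lemma Jpair_zero {a m : ℕ} (ha : a ≠ 0) (ham : a < m) : Jpair 0 a m = 1 := by
  rw [Jpair, zero_pow ha, zero_pow (by omega), zero_pow (by omega), qPochInf_zero]
  norm_num

end

end QSeries

theorem mainTheorem3 (q : ℂ) (hq : ‖q‖ < 1) :
    (∀ u v w t : ℂ, Summable (QSeries.termF u v w t q)) ∧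
    (∀ u v w t : ℂ, QSeries.F u v w t q = QSeries.F u w v t q) ∧
    QSeries.F 1 1 1 1 q =
      QSeries.J q 2 ^ 6 * QSeries.J q 14 * QSeries.J q 28 ^ 5 /
          (QSeries.J q 1 ^ 3 * QSeries.J q 4 ^ 3 *
            QSeries.Jpair q 2 28 * QSeries.Jpair q 3 28 * QSeries.Jpair q 7 28 *
            QSeries.Jpair q 8 28 * QSeries.Jpair q 11 28 * QSeries.Jpair q 12 28) +
        4 * q * (QSeries.J q 4 ^ 3 * QSeries.Jpair q 8 28 / QSeries.J q 2 ^ 4) ∧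
    QSeries.F 1 1 1 q q =
      QSeries.J q 2 ^ 6 * QSeries.J q 14 * QSeries.J q 28 ^ 5 /
          (QSeries.J q 1 ^ 3 * QSeries.J q 4 ^ 3 *
            QSeries.Jpair q 4 28 * QSeries.Jpair q 5 28 * QSeries.Jpair q 6 28 *
            QSeries.Jpair q 7 28 * QSeries.Jpair q 8 28 * QSeries.Jpair q 9 28) +
        4 * q ^ 2 * (QSeries.J q 4 ^ 3 * QSeries.Jpair q 4 28 / QSeries.J q 2 ^ 4) ∧
    (q ≠ 0 →
      QSeries.F q⁻¹ q q⁻¹ 1 q =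
        4 * (QSeries.J q 4 ^ 3 * QSeries.Jpair q 12 28 / QSeries.J q 2 ^ 4) +
          QSeries.J q 2 ^ 6 * QSeries.J q 14 * QSeries.J q 28 ^ 5 /
            (QSeries.J q 1 ^ 3 * QSeries.J q 4 ^ 3 *
              QSeries.Jpair q 1 28 * QSeries.Jpair q 4 28 * QSeries.Jpair q 7 28 *
              QSeries.Jpair q 10 28 * QSeries.Jpair q 12 28 * QSeries.Jpair q 13 28)) := by
  refine ⟨fun u v w t => QSeries.summable_termF u v w t hq,
    fun u v w t => QSeries.F_swap u v w t q, ?_⟩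
  rcases eq_or_ne q 0 with rfl | hq0
  · simp [QSeries.F_zero_right, QSeries.J_zero, QSeries.Jpair_zero]
  obtain ⟨s1, s2, s3⟩ := QSeries.rogers_selberg_neg hq0 hq
  obtain ⟨r1, r2, r3⟩ := QSeries.rogers_fourteen_sq hq0 hq
  refine ⟨?_, ?_, fun _ => ?_⟩
  · rw [QSeries.F_one_one_one 1 hq0 hq]
    simp only [one_pow, one_mul]
    rw [s1, r2, QSeries.qPochInf_neg_eq hq, QSeries.qPochInf_neg_sq_eq hq]
    ring
  -- Taking `t = q` multiplies the terms by `(q²)^m`, which passes to the second Rogers–Selberg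
  -- series and the third Rogers series.
  · have e1 : ∀ m : ℕ, q ^ (2 * m) * (q ^ 2) ^ (m ^ 2) = (q ^ 2) ^ (m ^ 2 + m) := fun m => by
      rw [pow_mul, ← pow_add, add_comm]
    have e2 : ∀ m : ℕ, q ^ (2 * m) * (q ^ 2) ^ (m ^ 2 + m) = (q ^ 2) ^ (m ^ 2 + 2 * m) :=
      fun m => by rw [pow_mul, ← pow_add]; congr 1; ring
    rw [QSeries.F_one_one_one q hq0 hq]
    simp only [e1, e2]
    rw [s2, r3, QSeries.qPochInf_neg_eq hq, QSeries.qPochInf_neg_sq_eq hq]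
    ring
  · rw [QSeries.F_inv_self_inv hq0 hq, s3, r1, QSeries.qPochInf_neg_eq hq,
      QSeries.qPochInf_neg_sq_eq hq]
    ring
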